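/- Let $R$ be an irreducible reduced (crystallographic) root system with simple roots $\alpha_1,\dots,\alpha_n$, positive roots $R_+$, Weyl group $W$ with longest element $w_0$, coroots $\alpha^\vee$, weight lattice $P$ and dominant weights $P_+=\bigoplus_i\mathbb Z_{\ge 0}\,\omega_i$. Normalize the $W$-invariant form by $(\alpha,\alpha)=2$ for short roots and put $\nu_\alpha=(\alpha,\alpha)/2$. We treat two cases. * Untwisted: $\theta$ is the maximal root, $\varrho=\frac12\sum_{\alpha\in R_+}\alpha^\vee$, and $\widehat W=W\ltimes P^\vee$. * Twisted: $\theta$ is the maximal short root (so $\theta^\vee$ is the maximal coroot), $\varrho=\frac12\sum_{\alpha\in R_+}\alpha$, and $\widehat W=W\ltimes P$. The group $\widehat W$ acts on $\mathbb R^n\times\mathbb R$ by $w([z,\zeta])=[w(z),\zeta]$ for $w\in W$ and $a([z,\zeta])=[z,\zeta-(z,a)]$ for $a$ in the lattice $P^\vee$, respectively $P$. The simple affine roots are $\alpha_0=[-\theta,1]$ and $\alpha_i=[\alpha_i,0]$, $1\le i\le n$. The simple affine reflections are $s_i([z,\zeta])=[z,\zeta]-(z,\alpha_i^\vee)\,\alpha_i$,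 where $(z,\alpha_0^\vee)=-(z,\theta^\vee)$. Let $\Pi\subset\widehat W$ be the subgroup of elements that permute the simple affine roots. Put $X_{[b,\zeta]}=q^{\zeta}X_b$; fractional powers of $q$ are allowed. Let $\widehat W$ act by $\hat w(X_{[b,\zeta]})=X_{\hat w([b,\zeta])}$. For $0\le i\le n$ let $\mathbb T_i$ be the operator, linear over the powers of $q$, such that for $b\in P$ $$\mathbb T_i(X_b)=\begin{cases}s_i(X_b)+X_b,&(b,\alpha_i)<0,\\ X_b,&(b,\alpha_i)=0,\\ 0,&(b,\alpha_i)>0,\end{cases}\qquad (b,\alpha_0)=-(b,\theta).$$ Let $\varrho\, w_0=\pi s_{i_l}\cdots s_{i_1}$ be any reduced decomposition in $\widehat W$, that is, one with $\pi\in\Pi$, $0\le i_k\le n$ and $l$ minimal. Put $\mathfrak T=\pi\,\mathbb T_{i_l}\cdots\mathbb T_{i_1}$. For $b\in P_+$ put $b^\iota=-w_0(b)$, the dominant element of the orbit $W(-b)$, and let $W^b$ be the stabilizer of $b$ in $W$. Let $$\mathbb E_{-b}=q^{-(\varrho,b)}\,\mathfrak T\Big(\sum_{c\in W(-b)}X_c\Big).$$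 Then the following hold in both cases. 1. For $b\in P_+$ and $u\in W$, the polynomial $\mathfrak T(X_{u(b)})$ is nonzero if and only if $u$ coincides modulo $W^b$ (that is, $uW^b=vW^b$) with an element $v$ that is the identity or a product of pairwise commuting simple reflections $s_i$, $1\le i\le n$. 2. For $b\in P_+$ and $w\in W$, the coefficient of $X_{w(-b)}$ in $\mathbb E_{-b}$ is $q^{-e(b,w)}$ for some integer $e(b,w)\ge 0$. There is exactly one coset $uW^{b^\iota}$ such that the monomial $q^{-e(b,w)}X_{w(-b)}$ has a nonzero coefficient in $q^{-(\varrho,b)}\,\mathfrak T(X_{u(b^\iota)})$, and this coset contains an element $u$ that is the identity or a product of pairwise commuting simple reflections. 3. Let $e(b,w;u)=e(b,w)$ if the monomial $q^{-e(b,w)}X_{w(-b)}$ has a nonzero coefficient in $q^{-(\varrho,b)}\,\mathfrak T(X_{u(b^\iota)})$, and $e(b,w;u)=0$ otherwise. Let $b,c\in P_+$ and $w,u\in W$. If $q^{-e(b+c,w)}X_{w(-b-c)}$ has a nonzero coefficient in $q^{-(\varrho,b+c)}\,\mathfrak T(X_{u((b+c)^\iota)})$, then the corresponding statements hold for $b$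 and for $c$ with the same $u$, and $$e(b+c,w;u)=e(b,w;u)+e(c,w;u).$$ This equality also holds for all $w,u\in W$ whenever $W^b=W^c$, in particular for regular $b,c$. -/

import Mathlib

/-- The two affine extensions of a finite root system `R`: the untwisted one `{[α, j]}`, and the
twisted one `{[α, ν_α j]}`. -/
inductive AffineType
  | untwisted
  | twisted

namespace DagPoly

noncomputable section

variable {ι M N : Type*} [Fintype ι] [AddCommGroup M] [Module ℝ M] [AddCommGroup N] [Module ℝ N]

/-! ### The finite root system

The pairing `⟨b, a⟩` of `b : M` with `a : N` is `R.toLinearMap b a`; the coweight space `N` plays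
the role of the Euclidean space in its second copy, so that `(z, α^∨) = R.coroot' i z`. -/

/-- `ν_α = (α, α) / 2` for the `W`-invariant form with `(α, α) = 2` on short roots, that is, the
ratio of the squared length of `α` and the squared length of the shortest roots.
(`R.RootForm` is a `W`-invariant inner product; on an irreducible system it is proportional to
the normalized one.) -/
def nu (R : RootPairing ι ℝ M N) (i : ι) : ℝ :=
  R.RootForm (R.root i) (R.root i) / ⨅ j, R.RootForm (R.root j) (R.root j)

/-- The multiplier of the imaginary part: affine roots are `[α, kap α * j]`, `j ∈ ℤ`. -/
def kap (R : RootPairing ι ℝ M N) : AffineType → ι → ℝ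
  | .untwisted, _ => 1
  | .twisted, i => nu R i

open scoped Classical in
/-- The functional `z ↦ (z, ρ̌)` in the untwisted case, where `ρ̌ = ½ ∑_{α > 0} α^∨`, and
`z ↦ (z, ρ)` in the twisted case, where `ρ = ½ ∑_{α > 0} α = ½ ∑_{α > 0} ν_α α^∨` for the
normalized form; in both cases as an element of `N`. -/
def rhoCheck {R : RootPairing ι ℝ M N} (Δ : R.Base) (t : AffineType) : N :=
  (1 / 2 : ℝ) • ∑ i, if Δ.IsPos i then kap R t i • R.coroot i else 0

/-- The root `θ` used for `α₀ = [-θ, 1]`: the maximal root in the untwisted case; in the twisted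
case the maximal short root, which is the root whose coroot is the maximal coroot. -/
def IsTheta {R : RootPairing ι ℝ M N} (Δ : R.Base) : AffineType → ι → Prop
  | .untwisted, θ => ∀ j, R.root θ - R.root j ∈ AddSubmonoid.closure (R.root '' Δ.support)
  | .twisted, θ => ∀ j, R.coroot θ - R.coroot j ∈ AddSubmonoid.closure (R.coroot '' Δ.support)

/-- The longest element of the Weyl group: it sends all positive roots to negative ones. -/
def IsLongest {R : RootPairing ι ℝ M N} (Δ : R.Base) (w₀ : R.weylGroup) : Prop :=
  ∀ i, Δ.IsPos i → ¬ Δ.IsPos (R.weylGroupToPerm w₀ i)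

/-- `P₊`, the nonnegative integral combinations of fundamental weights. -/
def IsDominant {R : RootPairing ι ℝ M N} (Δ : R.Base) (b : M) : Prop :=
  ∀ i ∈ Δ.support, ∃ n : ℕ, R.coroot' i b = n

/-- `u` is the identity or a product of (distinct) pairwise commuting simple reflections. -/
def IsCommutingProduct {R : RootPairing ι ℝ M N} (Δ : R.Base) (u : R.weylGroup) : Prop :=
  ∃ s : List Δ.support, s.Nodup ∧
    s.Pairwise (fun i j =>
      Commute (RootPairing.weylGroup.ofIdx R (i : ι)) (RootPairing.weylGroup.ofIdx R (j : ι))) ∧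
    u = (s.map fun i => RootPairing.weylGroup.ofIdx R (i : ι)).prod

/-! ### The affine Weyl group acting on `ℝⁿ × ℝ` -/

/-- The affine root `[α_i, j]`, for a pair `a = (i, j)`. -/
def affVec (R : RootPairing ι ℝ M N) (a : ι × ℝ) : M × ℝ := (R.root a.1, a.2)

/-- The reflection `[z, ζ] ↦ [z, ζ] - (z, α^∨) [α, j]` in the affine root `[α, j]`. -/
def affRefl (R : RootPairing ι ℝ M N) (a : ι × ℝ) : (M × ℝ) ≃ₗ[ℝ] (M × ℝ) :=
  Module.reflection (x := affVec R a) (f := (R.coroot' a.1).comp (LinearMap.fst ℝ M ℝ))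
    (by simp [affVec])

/-- The translation `[z, ζ] ↦ [z, ζ - (z, a)]`. -/
def transl (R : RootPairing ι ℝ M N) (a : N) : (M × ℝ) ≃ₗ[ℝ] (M × ℝ) where
  toFun x := (x.1, x.2 - R.toLinearMap x.1 a)
  invFun x := (x.1, x.2 + R.toLinearMap x.1 a)
  map_add' x y := by ext <;> simp; ring
  map_smul' c x := by ext <;> simp; ring
  left_inv x := by simp
  right_inv x := by simp

/-- The action `[z, ζ] ↦ [w z, ζ]` of the nonaffine Weyl group. -/
def finAct (R : RootPairing ι ℝ M N) (w : R.weylGroup) : (M × ℝ) ≃ₗ[ℝ] (M × ℝ) :=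
  LinearEquiv.prodCongr (RootPairing.Equiv.weightHom R (w : R.Aut)) (LinearEquiv.refl ℝ ℝ)

/-- The simple affine roots: `α₀ = [-θ, 1]` (index `none`) and `α_i = [α_i, 0]`.
The index of `-θ` is `R.reflectionPerm θ θ`. -/
def simpleAff {R : RootPairing ι ℝ M N} (Δ : R.Base) (θ : ι) : Option Δ.support → ι × ℝ
  | none => (R.reflectionPerm θ θ, 1)
  | some i => (i, 0)

/-- The extended affine Weyl group: `W ⋉ P^∨` in the untwisted and `W ⋉ P` in the twisted case.
An element `a : N` is in `P^∨` when `(α, a) ∈ ℤ` for all roots `α`. The functional of an element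
`a'` of the weight lattice `P` is characterized by `(α, a') = ν_α (a', α^∨) ∈ ν_α ℤ`. -/
def extAffWeyl (R : RootPairing ι ℝ M N) (t : AffineType) : Subgroup ((M × ℝ) ≃ₗ[ℝ] (M × ℝ)) :=
  Subgroup.closure (Set.range (finAct R) ∪
    transl R '' {a : N | ∀ i, ∃ n : ℤ, R.root' i a = n * kap R t i})

/-- The group `Π` of elements of length zero: those elements of the extended affine Weyl group
that permute the simple affine roots. -/
def IsLengthZero {R : RootPairing ι ℝ M N} (Δ : R.Base) (t : AffineType) (θ : ι)
    (g : (M × ℝ) ≃ₗ[ℝ] (M × ℝ)) : Prop :=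
  g ∈ extAffWeyl R t ∧
    g '' Set.range (fun p => affVec R (simpleAff Δ θ p)) =
      Set.range (fun p => affVec R (simpleAff Δ θ p))

/-- `ŵ = π_r s_{i_l} ⋯ s_{i_1}` with `π_r = g ∈ Π` and `l = [i_l, …, i_1]`. -/
def IsDecomposition {R : RootPairing ι ℝ M N} (Δ : R.Base) (t : AffineType) (θ : ι)
    (what g : (M × ℝ) ≃ₗ[ℝ] (M × ℝ)) (l : List (Option Δ.support)) : Prop :=
  IsLengthZero Δ t θ g ∧ what = g * (l.map fun p => affRefl R (simpleAff Δ θ p)).prod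

/-- A decomposition is reduced when its number of simple reflections is minimal. -/
def IsReducedDecomposition {R : RootPairing ι ℝ M N} (Δ : R.Base) (t : AffineType) (θ : ι)
    (what g : (M × ℝ) ≃ₗ[ℝ] (M × ℝ)) (l : List (Option Δ.support)) : Prop :=
  IsDecomposition Δ t θ what g l ∧
    ∀ g' l', IsDecomposition Δ t θ what g' l' → l.length ≤ l'.length

/-- The element `π_ρ = ρ̌ w₀` (in the twisted case `ρ w₀`). -/
def piRho {R : RootPairing ι ℝ M N} (Δ : R.Base) (t : AffineType) (w₀ : R.weylGroup) :
    (M × ℝ) ≃ₗ[ℝ] (M × ℝ) :=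
  transl R (rhoCheck Δ t) * finAct R w₀

/-! ### Polynomials

Integral combinations of the monomials `X_{[b, ζ]} = q^ζ X_b`, `b ∈ M`, `ζ ∈ ℝ`, which multiply by
adding exponents. This ring contains `ℤ[q, q⁻¹][X_b, b ∈ P]`, and the fractional powers of `q` that
come from the action of the extended affine Weyl group. -/

/-- The ring of polynomials in `q^ζ` and `X_b`. -/
abbrev QPoly (M : Type*) [AddCommGroup M] : Type _ := AddMonoidAlgebra ℤ (M × ℝ)

/-- The monomial `q^ζ X_b`, for `x = [b, ζ]`. -/
def mono (x : M × ℝ) : QPoly M := AddMonoidAlgebra.single x 1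

/-- The additive map with prescribed values on monomials. -/
def linExt (g : M × ℝ → QPoly M) : AddMonoid.End (QPoly M) :=
  (Finsupp.liftAddHom fun x => (smulAddHom ℤ (QPoly M)).flip (g x)).comp
    AddMonoidAlgebra.coeffAddEquiv.toAddMonoidHom

open scoped Classical in
/-- The operator `𝕋_α` for an affine root `α = [α, j]`: on `X_b`, it is `s_α(X_b) + X_b` if
`(b, α) < 0`, it is `X_b` if `(b, α) = 0`, and it is `0` if `(b, α) > 0`; it is linear over
powers of `q`. Here `(b, α)` only involves the nonaffine part of `α`, and has the sign of
`(b, α^∨)`. -/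
def natOp (R : RootPairing ι ℝ M N) (a : ι × ℝ) : AddMonoid.End (QPoly M) :=
  linExt fun x =>
    if R.coroot' a.1 x.1 < 0 then mono (affRefl R a x) + mono x
    else if R.coroot' a.1 x.1 = 0 then mono x
    else 0

/-- The operator `𝔗 = π_r 𝕋_{i_l} ⋯ 𝕋_{i_1}` of a decomposition `(g, [i_l, …, i_1])`, where
`g = π_r` acts by `X_x ↦ X_{g x}`. -/
def frakT {R : RootPairing ι ℝ M N} (Δ : R.Base) (θ : ι)
    (g : (M × ℝ) ≃ₗ[ℝ] (M × ℝ)) (l : List (Option Δ.support)) : AddMonoid.End (QPoly M) :=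
  linExt (fun x => mono (g x)) * (l.map fun p => natOp R (simpleAff Δ θ p)).prod

/-- `M_a`, the sum of `X_c` over the `W`-orbit of `a`. -/
def orbitSum (R : RootPairing ι ℝ M N) (a : M) : QPoly M :=
  ∑ᶠ c ∈ MulAction.orbit R.weylGroup a, mono (c, 0)

/-- `q^{(ρ̌, a)}` (in the twisted case `q^{(ρ, a)}`). -/
def qRho {R : RootPairing ι ℝ M N} (Δ : R.Base) (t : AffineType) (a : M) : QPoly M :=
  mono (0, R.toLinearMap a (rhoCheck Δ t))

/-- The extremal dag-polynomial `𝔼_a = q^{(ρ̌, a)} 𝔗(M_a)` (for `a ∈ P₋`). -/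
def dagPoly {R : RootPairing ι ℝ M N} (Δ : R.Base) (t : AffineType) (T : AddMonoid.End (QPoly M))
    (a : M) : QPoly M :=
  qRho Δ t a * T (orbitSum R a)

/-- The extremal dag-degree `e(b, w)`, `b ∈ P₊`: the term of `𝔼_{-b}` with `X_{w(-b)}` is
`q^{-e(b, w)} X_{w(-b)}`. -/
def dagDeg {R : RootPairing ι ℝ M N} (Δ : R.Base) (t : AffineType) (T : AddMonoid.End (QPoly M))
    (b : M) (w : R.weylGroup) : ℕ :=
  sInf {e : ℕ | (dagPoly Δ t T (-b)).coeff (w • (-b), -(e : ℝ)) ≠ 0}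

/-- `b^ι = -w₀(b)`, the dominant element of the orbit of `-b`. -/
def iotaInv {R : RootPairing ι ℝ M N} (w₀ : R.weylGroup) (b : M) : M := -(w₀ • b)

/-- The monomial `q^{-e(b, w)} X_{w(-b)}` of `𝔼_{-b}` occurs in the block
`q^{(ρ̌, -b)} 𝔗(X_{u(b^ι)})` of `𝔼_{-b}`. -/
def Arises {R : RootPairing ι ℝ M N} (Δ : R.Base) (t : AffineType) (w₀ : R.weylGroup)
    (T : AddMonoid.End (QPoly M)) (b : M) (w u : R.weylGroup) : Prop :=
  (qRho Δ t (-b) * T (mono (u • iotaInv w₀ b, 0))).coeff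
    (w • (-b), -(dagDeg Δ t T b w : ℝ)) ≠ 0

open scoped Classical in
/-- The refined degree `e(b, w; u)`. -/
def refDeg {R : RootPairing ι ℝ M N} (Δ : R.Base) (t : AffineType) (w₀ : R.weylGroup)
    (T : AddMonoid.End (QPoly M)) (b : M) (w u : R.weylGroup) : ℕ :=
  if Arises Δ t w₀ T b w u then dagDeg Δ t T b w else 0

end

end DagPoly

set_option linter.unusedSectionVars false

namespace DagPoly

open RootPairing

noncomputable section

variable {ι M N : Type*} [Fintype ι] [AddCommGroup M] [Module ℝ M] [AddCommGroup N] [Module ℝ N]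
  {R : RootPairing ι ℝ M N}

/-! ### The Weyl group, its invariant form, and positive roots -/

/-! On coefficients the operators are pullbacks: the coefficient of `X_y` in `𝕋_a f` is the
coefficient of `f` at `pull R a y`, which is `s_a y` if `(y, a^∨) > 0` and `y` otherwise
(`coeff_natOp`). Hence `𝔗` is the pullback along one map `φ = frakPull` of `M × ℝ`, which moves the
weight within its Weyl orbit and commutes with imaginary shifts. So each `X_{w(-b)}` occurs in
`𝔼_{-b}` with a single power of `q` and coefficient 1, and it comes from a single weight of the
orbit.

Nonvanishing: `𝔗(X_x) ≠ 0` means that `x` lies in the image of `φ`. For a reduced word this image is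
cut out by nonpositivity on the inversions of the product (`exists_pullWord_eq_iff`). The inversions
of `ρ̌ w₀` are the `[-β, ζ]` with `β > 0` and `0 < ζ < (ρ̌, β)`, `ζ ∈ κ_β ℤ`. As `(ρ̌, β) ≥ κ_β`,
with equality exactly for simple `β`, the condition is `(x, β^∨) ≥ 0` for all nonsimple `β > 0`. The
simple roots that are negative on such an `x` are pairwise orthogonal, and reflecting in all of them
makes `x` dominant (`nonneg_on_nonsimple_iff`).

Integrality and sign of the degree: `e(b, w)` is the imaginary part of `φ(w(-b), 0)` plus `(ρ̌, b)`.
It splits into the growth of the imaginary part along the word, where each skipped reflection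
contributes a nonnegative integer (`exists_nat_snd_pullWord`), and the defect `(ρ̌, b^ι) - (ρ̌, x)`
of a weight `x` in the orbit of `b^ι` (`exists_nat_rhoForm_sub_smul`).

Additivity: points of a common closed chamber make the same choices at every step, so `φ` is
additive on them and acts on them by a common Weyl element (`SameChamber.frakPull`). The degrees
`e(b, w)` are therefore additive outright, and the occurrence conditions for `b`, `c`, `b + c` say
that one and the same `h ∈ W` fixes the respective weight. For dominant weights, fixing `b + c`
forces fixing `b` and `c`. -/

lemma coroot'_perm_smul (w : R.weylGroup) (i : ι) (x : M) :
    R.coroot' (R.weylGroupToPerm w i) (w • x) = R.coroot' i x := by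
  revert i x
  obtain ⟨w, hw⟩ := w
  induction hw using weylGroup.induction with
  | mem k =>
    intro i x
    change R.coroot' (R.reflectionPerm k i) (R.reflection k x) = _
    rw [coroot'_reflection, reflectionPerm_self]
  | one => intro i x; rfl
  | mul g₁ g₂ hg₁ hg₂ h₁ h₂ =>
    intro i x
    rw [← Submonoid.mk_mul_mk _ _ _ hg₁ hg₂, mul_smul, map_mul]
    exact (h₁ _ _).trans (h₂ _ _)

lemma coroot'_smul (w : R.weylGroup) (i : ι) (x : M) :
    R.coroot' i (w • x) = R.coroot' (R.weylGroupToPerm w⁻¹ i) x := by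
  rw [← coroot'_perm_smul w (R.weylGroupToPerm w⁻¹ i) x, ← Equiv.Perm.mul_apply, ← map_mul]
  simp

lemma perm_reflectionPerm_self (w : R.weylGroup) (i : ι) :
    R.weylGroupToPerm w (R.reflectionPerm i i) =
      R.reflectionPerm (R.weylGroupToPerm w i) (R.weylGroupToPerm w i) := by
  apply R.root.injective
  rw [← weylGroup_apply_root, root_reflectionPerm, root_reflectionPerm, reflection_apply_self,
    reflection_apply_self, ← weylGroup_apply_root, smul_neg]

lemma coroot'_reflectionPerm_self (i : ι) (x : M) :
    R.coroot' (R.reflectionPerm i i) x = - R.coroot' i x := by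
  rw [coroot'_reflectionPerm]
  simp [reflection_apply]
  ring

lemma root_reflectionPerm_self (i : ι) : R.root (R.reflectionPerm i i) = -R.root i := by
  rw [root_reflectionPerm, reflection_apply_self]

lemma ofIdx_smul_eq (i : ι) (x : M) : weylGroup.ofIdx R i • x = R.reflection i x := rfl

lemma weylGroupToPerm_ofIdx (i j : ι) :
    R.weylGroupToPerm (weylGroup.ofIdx R i) j = R.reflectionPerm i j := rfl

lemma two_mul_rootForm_root (x : M) (i : ι) :
    2 * R.RootForm x (R.root i) = R.coroot' i x * R.RootForm (R.root i) (R.root i) := by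
  have h := R.rootForm_reflection_reflection_apply i x (R.root i)
  rw [reflection_apply_self, reflection_apply] at h
  simp only [map_neg, map_sub, LinearMap.sub_apply, map_smul, LinearMap.smul_apply,
    smul_eq_mul] at h
  linarith

lemma rootForm_root_pos (i : ι) : 0 < R.RootForm (R.root i) (R.root i) :=
  R.rootForm_pos_of_ne_zero (Submodule.subset_span ⟨i, rfl⟩) (R.ne_zero i)

lemma isPos_neg_iff (Δ : R.Base) (i : ι) : Δ.IsPos (R.reflectionPerm i i) ↔ ¬ Δ.IsPos i :=
  Base.IsPos.neg_iff_not Δ i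

/-! ### Functionals on the cone of positive roots -/

lemma apply_nonneg_of_mem_closure {V : Type*} [AddCommGroup V] [Module ℝ V] {s : Set V}
    (f : V →ₗ[ℝ] ℝ) (hf : ∀ v ∈ s, 0 ≤ f v) {x : V} (hx : x ∈ AddSubmonoid.closure s) :
    0 ≤ f x := by
  induction hx using AddSubmonoid.closure_induction with
  | mem v hv => exact hf v hv
  | zero => simp
  | add x y _ _ hx hy => rw [map_add]; positivity

lemma eq_zero_or_apply_pos_of_mem_closure {V : Type*} [AddCommGroup V] [Module ℝ V] {s : Set V}
    (f : V →ₗ[ℝ] ℝ) (hf : ∀ v ∈ s, 0 < f v) {x : V} (hx : x ∈ AddSubmonoid.closure s) :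
    x = 0 ∨ 0 < f x := by
  induction hx using AddSubmonoid.closure_induction with
  | mem v hv => exact .inr (hf v hv)
  | zero => simp
  | add x y _ _ hx hy =>
    rcases hx with rfl | hx <;> rcases hy with rfl | hy <;> simp_all
    right; positivity

lemma root_mem_closure_of_isPos {Δ : R.Base} {i : ι} (hi : Δ.IsPos i) :
    R.root i ∈ AddSubmonoid.closure (R.root '' Δ.support) := by
  obtain ⟨f, hf, h | h⟩ := Δ.exists_root_eq_sum_nat_or_neg i
  · rw [h]
    exact sum_mem fun j hj => nsmul_mem
      (AddSubmonoid.subset_closure (Set.mem_image_of_mem R.root hj)) _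
  · exfalso
    have h' : R.root i = ∑ j ∈ Δ.support, (-(f j : ℤ)) • R.root j := by
      rw [h]; simp
    have := Base.height_eq_sum h'
    rw [Base.isPos_iff, this] at hi
    have : 0 ≤ ∑ j ∈ Δ.support, (f j : ℤ) := by positivity
    simp at hi
    omega

lemma apply_root_nonneg_of_isPos {Δ : R.Base} (f : M →ₗ[ℝ] ℝ)
    (hf : ∀ i ∈ Δ.support, 0 ≤ f (R.root i)) {i : ι} (hi : Δ.IsPos i) : 0 ≤ f (R.root i) :=
  apply_nonneg_of_mem_closure f (by rintro _ ⟨j, hj, rfl⟩; exact hf j hj)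
    (root_mem_closure_of_isPos hi)

lemma coroot'_nonneg_iff (i : ι) (z : M) :
    0 ≤ R.coroot' i z ↔ 0 ≤ R.RootForm z (R.root i) := by
  have h := two_mul_rootForm_root (R := R) z i
  have hp := rootForm_root_pos (R := R) i
  constructor <;> intro h'
  · nlinarith
  · by_contra! hc
    nlinarith

lemma coroot'_nonneg_of_isPos {Δ : R.Base} {z : M} (hz : ∀ i ∈ Δ.support, 0 ≤ R.coroot' i z)
    {j : ι} (hj : Δ.IsPos j) : 0 ≤ R.coroot' j z := by
  rw [coroot'_nonneg_iff]
  exact apply_root_nonneg_of_isPos (R.RootForm z)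
    (fun i hi => (coroot'_nonneg_iff i z).1 (hz i hi)) hj

lemma isPos_reflectionPerm_iff [R.IsCrystallographic] [R.IsReduced] {Δ : R.Base} {i j : ι}
    (hi : i ∈ Δ.support) (h₁ : j ≠ i) (h₂ : j ≠ R.reflectionPerm i i) :
    Δ.IsPos (R.reflectionPerm i j) ↔ Δ.IsPos j := by
  refine ⟨fun h => ?_, fun h => h.reflectionPerm hi h₁⟩
  rw [← R.reflectionPerm_self i j]
  refine h.reflectionPerm hi fun h' => h₂ ?_
  rw [← R.reflectionPerm_self i j, h']

/-! ### The multipliers `κ_α` and the vector `ρ̌` -/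

lemma nu_pos (i : ι) : 0 < nu R i := by
  have : Nonempty ι := ⟨i⟩
  obtain ⟨j, hj⟩ := exists_eq_ciInf_of_finite (f := fun j => R.RootForm (R.root j) (R.root j))
  rw [nu, ← hj]
  exact div_pos (rootForm_root_pos i) (rootForm_root_pos j)

lemma kap_pos (t : AffineType) (i : ι) : 0 < kap R t i := by
  cases t
  · exact one_pos
  · exact nu_pos i

lemma kap_perm (t : AffineType) (w : R.weylGroup) (i : ι) :
    kap R t (R.weylGroupToPerm w i) = kap R t i := by
  cases t
  · rfl
  · have := InvariantForm.apply_weylGroup_smul R (B := R.toInvariantForm) w (R.root i) (R.root i)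
    rw [weylGroup_apply_root] at this
    simp only [kap, nu]
    congr 1

lemma kap_reflectionPerm (t : AffineType) (i j : ι) :
    kap R t (R.reflectionPerm i j) = kap R t j :=
  kap_perm t (weylGroup.ofIdx R i) j

lemma pairing_mul_nu (i j : ι) : R.pairing i j * nu R j = R.pairing j i * nu R i := by
  have h := R.toInvariantForm.pairing_mul_eq_pairing_mul_swap i j
  rw [nu, nu, ← mul_div_assoc, ← mul_div_assoc]
  congr 1
  exact h.symm

/-- This integrality makes affine reflections preserve affine roots. In the twisted case `ν`
symmetrizes the Cartan matrix, so the transposed Cartan integer appears. -/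
lemma exists_int_pairing_mul_kap [R.IsCrystallographic] (t : AffineType) (i j : ι) :
    ∃ n : ℤ, R.pairing i j * kap R t j = n * kap R t i := by
  have h (i j : ι) : R.pairing i j = R.pairingIn ℤ i j := (R.algebraMap_pairingIn ℤ i j).symm
  cases t
  · exact ⟨R.pairingIn ℤ i j, by simp [kap, h]⟩
  · exact ⟨R.pairingIn ℤ j i, by rw [kap, kap, pairing_mul_nu, h]⟩

/-- The functional `z ↦ (z, ρ̌)`. -/
def rhoForm (Δ : R.Base) (t : AffineType) : M →ₗ[ℝ] ℝ := R.toLinearMap.flip (rhoCheck Δ t)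

open scoped Classical in
lemma rhoForm_apply (Δ : R.Base) (t : AffineType) (x : M) :
    rhoForm Δ t x = (1 / 2) * ∑ i, if Δ.IsPos i then kap R t i * R.coroot' i x else 0 := by
  rw [rhoForm, rhoCheck, LinearMap.flip_apply, map_smul, map_sum, smul_eq_mul]
  congr 1
  refine Finset.sum_congr rfl fun i _ => ?_
  split_ifs <;> simp

open scoped Classical in
-- The simple reflection permutes the positive roots other than `α_i`, so only the summand of `α_i`
-- changes sign.
lemma rhoForm_reflection [R.IsCrystallographic] [R.IsReduced] (Δ : R.Base) (t : AffineType)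
    {i : ι} (hi : i ∈ Δ.support) (x : M) :
    rhoForm Δ t (R.reflection i x) = rhoForm Δ t x - kap R t i * R.coroot' i x := by
  rw [rhoForm_apply, rhoForm_apply]
  have key : (∑ j, if Δ.IsPos j then kap R t j * R.coroot' j (R.reflection i x) else 0) =
      ∑ j, ((if Δ.IsPos j then kap R t j * R.coroot' j x else 0) +
        ((if j = i then -(kap R t i * R.coroot' i x) else 0) +
         (if j = R.reflectionPerm i i then -(kap R t i * R.coroot' i x) else 0))) := by
    refine Fintype.sum_equiv (R.reflectionPerm i) _ _ fun j => ?_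
    rw [coroot'_reflection, kap_reflectionPerm]
    have hpi := Base.isPos_of_mem_support hi
    have hni : ¬ Δ.IsPos (R.reflectionPerm i i) := by rw [isPos_neg_iff]; simpa
    have hne : i ≠ R.reflectionPerm i i := fun h => hni (h ▸ hpi)
    by_cases h₁ : j = i
    · subst h₁
      simp [hpi, hni, hne.symm]
    by_cases h₂ : j = R.reflectionPerm i i
    · subst h₂
      simp [hpi, hni, hne, kap_reflectionPerm]
    · have h₃ : R.reflectionPerm i j ≠ i := fun h => h₂ (by rw [← R.reflectionPerm_self i j, h])
      have h₄ : R.reflectionPerm i j ≠ R.reflectionPerm i i := fun h =>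
        h₁ ((R.reflectionPerm i).injective h)
      rw [isPos_reflectionPerm_iff hi h₁ h₂]
      simp [h₃, h₁]
  rw [key, Finset.sum_add_distrib, Finset.sum_add_distrib]
  simp
  ring

lemma rhoForm_simple [R.IsCrystallographic] [R.IsReduced] (Δ : R.Base) (t : AffineType)
    {i : ι} (hi : i ∈ Δ.support) : rhoForm Δ t (R.root i) = kap R t i := by
  have := rhoForm_reflection Δ t hi (R.root i)
  rw [reflection_apply_self, map_neg, root_coroot'_eq_pairing, pairing_same] at this
  linarith

lemma isPos_longest_iff {Δ : R.Base} {w₀ : R.weylGroup} (hw₀ : IsLongest Δ w₀) (i : ι) :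
    Δ.IsPos (R.weylGroupToPerm w₀ i) ↔ ¬ Δ.IsPos i := by
  refine ⟨fun h h' => hw₀ i h' h, fun h => ?_⟩
  have := hw₀ _ ((isPos_neg_iff Δ i).2 h)
  rwa [perm_reflectionPerm_self, isPos_neg_iff, not_not] at this

open scoped Classical in
lemma rhoForm_longest {Δ : R.Base} (t : AffineType) {w₀ : R.weylGroup} (hw₀ : IsLongest Δ w₀)
    (x : M) : rhoForm Δ t (w₀ • x) = - rhoForm Δ t x := by
  rw [rhoForm_apply, rhoForm_apply]
  have hinv : Function.Involutive fun i => R.reflectionPerm i i := fun i => by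
    apply R.root.injective
    rw [root_reflectionPerm_self, root_reflectionPerm_self, neg_neg]
  have key : (∑ i, if Δ.IsPos i then kap R t i * R.coroot' i x else 0) =
      ∑ i, if ¬ Δ.IsPos i then -(kap R t i * R.coroot' i x) else 0 := by
    refine Fintype.sum_equiv hinv.toPerm _ _ fun i => ?_
    simp only [Function.Involutive.coe_toPerm, isPos_neg_iff, not_not, kap_reflectionPerm,
      coroot'_reflectionPerm_self, mul_neg, neg_neg]
  have key₂ : (∑ i, if Δ.IsPos i then kap R t i * R.coroot' i (w₀ • x) else 0) =
      ∑ i, if ¬ Δ.IsPos i then kap R t i * R.coroot' i x else 0 := by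
    refine (Fintype.sum_equiv (R.weylGroupToPerm w₀) _ _ fun i => ?_).symm
    simp only [isPos_longest_iff hw₀, kap_perm, coroot'_perm_smul]
  rw [key, key₂, ← mul_neg, ← Finset.sum_neg_distrib]
  congr 1
  refine Finset.sum_congr rfl fun i _ => ?_
  split_ifs <;> simp

lemma exists_int_rhoForm_root [R.IsCrystallographic] [R.IsReduced] (Δ : R.Base) (t : AffineType)
    (i : ι) : ∃ n : ℤ, rhoForm Δ t (R.root i) = n * kap R t i := by
  refine Base.induction_reflect (b := Δ) i
    (p := fun i => ∃ n : ℤ, rhoForm Δ t (R.root i) = n * kap R t i) ?_ ?_ ?_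
  · rintro i ⟨n, hn⟩
    exact ⟨-n, by rw [root_reflectionPerm_self, map_neg, hn, kap_reflectionPerm]; simp⟩
  · exact fun i hi => ⟨1, by rw [rhoForm_simple Δ t hi]; simp⟩
  · rintro i j ⟨n, hn⟩ hj
    obtain ⟨m, hm⟩ := exists_int_pairing_mul_kap (R := R) t i j
    refine ⟨n - m, ?_⟩
    rw [root_reflectionPerm, rhoForm_reflection Δ t hj, kap_reflectionPerm, hn,
      root_coroot'_eq_pairing, mul_comm (kap R t j), hm]
    push_cast; ring

lemma rhoForm_root_pos [R.IsCrystallographic] [R.IsReduced] {Δ : R.Base} (t : AffineType)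
    {i : ι} (hi : Δ.IsPos i) : 0 < rhoForm Δ t (R.root i) := by
  refine (eq_zero_or_apply_pos_of_mem_closure (rhoForm Δ t) ?_
    (root_mem_closure_of_isPos hi)).resolve_left (R.ne_zero i)
  rintro _ ⟨j, hj, rfl⟩
  rw [rhoForm_simple Δ t hj]
  exact kap_pos t j

lemma rhoForm_root_pos_iff [R.IsCrystallographic] [R.IsReduced] {Δ : R.Base} (t : AffineType)
    {i : ι} : 0 < rhoForm Δ t (R.root i) ↔ Δ.IsPos i := by
  refine ⟨fun h => ?_, rhoForm_root_pos t⟩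
  by_contra hi
  have := rhoForm_root_pos t ((isPos_neg_iff Δ i).2 hi)
  rw [root_reflectionPerm_self, map_neg] at this
  linarith

lemma kap_le_rhoForm_root [R.IsCrystallographic] [R.IsReduced] {Δ : R.Base} (t : AffineType)
    {i : ι} (hi : Δ.IsPos i) : kap R t i ≤ rhoForm Δ t (R.root i) := by
  obtain ⟨n, hn⟩ := exists_int_rhoForm_root Δ t i
  have h := rhoForm_root_pos t hi
  have hk := kap_pos (R := R) t i
  rw [hn] at h ⊢
  have : (0 : ℝ) < n := pos_of_mul_pos_left h hk.le
  have : (1 : ℝ) ≤ n := by exact_mod_cast this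
  nlinarith

/-- Some simple `α_j` pairs positively with a nonsimple positive root; the reflected root is still
positive, and its height is smaller by a positive amount but at least `κ`. -/
lemma kap_lt_rhoForm_root [R.IsCrystallographic] [R.IsReduced] {Δ : R.Base} (t : AffineType)
    {i : ι} (hi : Δ.IsPos i) (hi' : i ∉ Δ.support) : kap R t i < rhoForm Δ t (R.root i) := by
  obtain ⟨j, hj, hij⟩ := hi.exists_mem_support_pos_pairingIn
  rw [R.zero_lt_pairingIn_iff'] at hij
  have hij' : 0 < R.pairing i j := by rw [← R.algebraMap_pairingIn ℤ]; simpa using hij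
  have h := kap_le_rhoForm_root t (hi.reflectionPerm hj (fun h => hi' (h ▸ hj)))
  rw [root_reflectionPerm, rhoForm_reflection Δ t hj, kap_reflectionPerm,
    root_coroot'_eq_pairing] at h
  have := mul_pos (kap_pos (R := R) t j) hij'
  linarith

end

end DagPoly

namespace DagPoly

open RootPairing

noncomputable section

variable {ι M N : Type*} [Fintype ι] [AddCommGroup M] [Module ℝ M] [AddCommGroup N] [Module ℝ N]
  {R : RootPairing ι ℝ M N}

/-! ### The maximal root and the maximal short root -/

lemma root_ne_neg_root {P : RootPairing ι ℝ M N} (i : ι) : P.root i ≠ -P.root i := fun h => by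
  have h₂ := congrArg (P.coroot' i) h
  rw [map_neg, root_coroot'_eq_pairing, pairing_same] at h₂
  norm_num at h₂

/-- Maximality is tested on the reflected root `s_k θ`. The pairing `P` is arbitrary because the
twisted case applies this to `R.flip`, where `θ^∨` is the maximal root. -/
lemma pairing_nonneg_of_maximal {P : RootPairing ι ℝ M N} {S : Set ι} (f : M →ₗ[ℝ] ℝ)
    (hf : ∀ i ∈ S, 0 < f (P.root i)) {θ : ι}
    (hθ : ∀ j, P.root θ - P.root j ∈ AddSubmonoid.closure (P.root '' S)) {k : ι} (hk : k ∈ S) :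
    0 ≤ P.pairing θ k := by
  have h := apply_nonneg_of_mem_closure f
    (by rintro _ ⟨j, hj, rfl⟩; exact (hf j hj).le) (hθ (P.reflectionPerm k θ))
  rw [root_reflectionPerm, reflection_apply_root, sub_sub_cancel, map_smul, smul_eq_mul] at h
  exact nonneg_of_mul_nonneg_left h (hf k hk)

lemma apply_maximal_pos {P : RootPairing ι ℝ M N} {S : Set ι} (f : M →ₗ[ℝ] ℝ)
    (hf : ∀ i ∈ S, 0 < f (P.root i)) {θ : ι}
    (hθ : ∀ j, P.root θ - P.root j ∈ AddSubmonoid.closure (P.root '' S)) {j : ι}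
    (hj : P.root j ≠ -P.root θ) : 0 < f (P.root θ) + f (P.root j) := by
  have h := eq_zero_or_apply_pos_of_mem_closure f
    (by rintro _ ⟨j, hj, rfl⟩; exact hf j hj) (hθ (P.reflectionPerm j j))
  rw [root_reflectionPerm_self, sub_neg_eq_add, map_add] at h
  exact h.resolve_left fun h => hj (eq_neg_of_add_eq_zero_right h)

/-- If the pairing were at most `-2`, then `s_θ β` would exceed `θ` in height, because `f(θ) + f(β)
> 0` for `β ≠ -θ`. -/
lemma neg_one_le_pairing_of_maximal {P : RootPairing ι ℝ M N} [P.IsCrystallographic] {S : Set ι}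
    (f : M →ₗ[ℝ] ℝ) (hf : ∀ i ∈ S, 0 < f (P.root i)) {θ : ι}
    (hθ : ∀ j, P.root θ - P.root j ∈ AddSubmonoid.closure (P.root '' S)) {j : ι}
    (hj : P.root j ≠ -P.root θ) : -1 ≤ P.pairing j θ := by
  by_contra! hc
  have hint : P.pairing j θ = P.pairingIn ℤ j θ := (P.algebraMap_pairingIn ℤ j θ).symm
  rw [hint] at hc
  have hc' : P.pairingIn ℤ j θ < -1 := by exact_mod_cast hc
  have hc2 : (P.pairingIn ℤ j θ : ℝ) ≤ -2 := by
    have : P.pairingIn ℤ j θ ≤ -2 := by omega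
    exact_mod_cast this
  have h₁ := apply_nonneg_of_mem_closure f
    (by rintro _ ⟨j, hj, rfl⟩; exact (hf j hj).le) (hθ (P.reflectionPerm θ j))
  rw [root_reflectionPerm, reflection_apply_root, map_sub, map_sub, map_smul, smul_eq_mul,
    hint] at h₁
  have h₂ := apply_maximal_pos f hf hθ hj
  have h₃ := apply_maximal_pos f hf hθ (j := θ)
    (root_ne_neg_root θ)
  nlinarith

/-- The functional on the coweight space that corresponds to a functional on the weight space. -/
def dualForm (R : RootPairing ι ℝ M N) [R.IsRootSystem] (f : M →ₗ[ℝ] ℝ) : N →ₗ[ℝ] ℝ :=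
  f ∘ₗ R.PolarizationEquiv.symm.toLinearMap

lemma dualForm_coroot [R.IsRootSystem] (f : M →ₗ[ℝ] ℝ) (i : ι) :
    dualForm R f (R.coroot i) = 2 / R.RootForm (R.root i) (R.root i) * f (R.root i) := by
  simp [dualForm, polarizationEquiv_symm_apply_coroot]

lemma dualForm_coroot_pos_iff [R.IsRootSystem] (f : M →ₗ[ℝ] ℝ) (i : ι) :
    0 < dualForm R f (R.coroot i) ↔ 0 < f (R.root i) := by
  have := rootForm_root_pos (R := R) i
  rw [dualForm_coroot]
  exact mul_pos_iff_of_pos_left (by positivity)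

lemma dualForm_rhoForm_pos [R.IsRootSystem] [R.IsCrystallographic] [R.IsReduced] (Δ : R.Base)
    (t : AffineType) : ∀ i ∈ (Δ.support : Set ι),
      0 < dualForm R (rhoForm Δ t) (R.flip.root i) := fun i hi => by
  rw [flip_root, dualForm_coroot_pos_iff, rhoForm_simple Δ t hi]
  exact kap_pos t i

lemma rhoForm_pos [R.IsCrystallographic] [R.IsReduced] (Δ : R.Base)
    (t : AffineType) : ∀ i ∈ (Δ.support : Set ι), 0 < rhoForm Δ t (R.root i) := fun i hi => by
  rw [rhoForm_simple Δ t hi]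
  exact kap_pos t i

lemma pairing_nonneg_iff (i j : ι) : 0 ≤ R.pairing i j ↔ 0 ≤ R.pairing j i := by
  rw [← root_coroot'_eq_pairing, ← root_coroot'_eq_pairing, coroot'_nonneg_iff, coroot'_nonneg_iff,
    ← R.rootForm_symmetric.eq, RingHom.id_apply]

section Theta

variable [R.IsRootSystem] [R.IsCrystallographic] [R.IsReduced] {Δ : R.Base} {t : AffineType}
  {θ : ι}

lemma isPos_theta (hθ : IsTheta Δ t θ) : Δ.IsPos θ := by
  rw [← rhoForm_root_pos_iff t]
  cases t
  · have := apply_maximal_pos _ (rhoForm_pos Δ .untwisted) hθ (j := θ)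
      (root_ne_neg_root θ)
    linarith
  · rw [← dualForm_coroot_pos_iff]
    have := apply_maximal_pos (P := R.flip) _ (dualForm_rhoForm_pos Δ .twisted) hθ (j := θ)
      (root_ne_neg_root θ)
    rw [flip_root] at this
    linarith

lemma pairing_theta_nonneg (hθ : IsTheta Δ t θ) {k : ι} (hk : Δ.IsPos k) :
    0 ≤ R.pairing k θ := by
  rw [pairing_nonneg_iff, ← root_coroot'_eq_pairing]
  refine coroot'_nonneg_of_isPos (fun i hi => ?_) hk
  rw [root_coroot'_eq_pairing]
  cases t
  · exact pairing_nonneg_of_maximal _ (rhoForm_pos Δ .untwisted) hθ hi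
  · rw [pairing_nonneg_iff]
    exact pairing_nonneg_of_maximal (P := R.flip) _ (dualForm_rhoForm_pos Δ .twisted) hθ hi

lemma neg_one_le_pairing_theta_twisted (hθ : IsTheta Δ .twisted θ) {j : ι}
    (hj : R.root j ≠ -R.root θ) : -1 ≤ R.pairing θ j := by
  refine neg_one_le_pairing_of_maximal (P := R.flip) _ (dualForm_rhoForm_pos Δ .twisted) hθ ?_
  rw [flip_root]
  intro h
  exact hj (R.root_eq_neg_iff.2 (R.coroot_eq_neg_iff.1 h))

/-- By irreducibility some root `k` of the same length as `j` is not orthogonal to `θ`. If `k ≠ ±θ`,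
then `(θ, k^∨) = ±1`, and the ratio of squared lengths is the integer `|(k, θ^∨)|`. So `θ` is
shortest and the multipliers `κ` are integers. -/
lemma rootForm_theta_dvd [R.IsIrreducible] (hθ : IsTheta Δ .twisted θ) (j : ι) :
    ∃ n : ℕ, 0 < n ∧ R.RootForm (R.root j) (R.root j) = n * R.RootForm (R.root θ) (R.root θ) := by
  obtain ⟨k, hk, hk'⟩ := R.exists_form_eq_form_and_form_ne_zero R.toInvariantForm θ j
  change R.RootForm _ _ = R.RootForm _ _ at hk
  replace hk' : R.pairing θ k ≠ 0 := fun h =>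
    hk' ((R.toInvariantForm.apply_root_root_zero_iff θ k).2 h)
  rw [← hk]
  by_cases h₁ : R.root k = -R.root θ
  · exact ⟨1, one_pos, by rw [h₁]; simp⟩
  by_cases h₂ : R.root k = R.root θ
  · exact ⟨1, one_pos, by rw [h₂]; simp⟩
  have h₃ := neg_one_le_pairing_theta_twisted hθ h₁
  have h₄ := neg_one_le_pairing_theta_twisted hθ (j := R.reflectionPerm k k)
    (by rwa [root_reflectionPerm_self, ne_eq, neg_inj])
  rw [pairing_reflectionPerm_self_right] at h₄
  have hsw := R.toInvariantForm.pairing_mul_eq_pairing_mul_swap θ k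
  change _ * R.RootForm _ _ = _ * R.RootForm _ _ at hsw
  have e₁ : R.pairing θ k = R.pairingIn ℤ θ k := (R.algebraMap_pairingIn ℤ θ k).symm
  have e₂ : R.pairing k θ = R.pairingIn ℤ k θ := (R.algebraMap_pairingIn ℤ k θ).symm
  rw [e₁] at h₃ h₄ hk'
  rw [e₁, e₂] at hsw
  have h₅ : R.pairingIn ℤ θ k = 1 ∨ R.pairingIn ℤ θ k = -1 := by
    have a : -1 ≤ R.pairingIn ℤ θ k := by exact_mod_cast h₃
    have b : -1 ≤ -R.pairingIn ℤ θ k := by exact_mod_cast h₄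
    have c : R.pairingIn ℤ θ k ≠ 0 := by exact_mod_cast hk'
    omega
  have hp := rootForm_root_pos (R := R) k
  have hq := rootForm_root_pos (R := R) θ
  have hn : R.RootForm (R.root k) (R.root k) =
      ((R.pairingIn ℤ k θ).natAbs : ℝ) * R.RootForm (R.root θ) (R.root θ) := by
    rw [Nat.cast_natAbs, Int.cast_abs]
    rcases h₅ with h | h <;> rw [h] at hsw <;> push_cast at hsw
    · rw [abs_of_nonneg, hsw, one_mul]
      by_contra! hc
      nlinarith
    · rw [abs_of_nonpos]
      · linarith
      · by_contra! hc
        nlinarith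
  refine ⟨_, Nat.pos_of_ne_zero fun h => ?_, hn⟩
  rw [h] at hn
  simp at hn
  linarith

lemma iInf_rootForm_eq_theta [R.IsIrreducible] (hθ : IsTheta Δ .twisted θ) :
    ⨅ j, R.RootForm (R.root j) (R.root j) = R.RootForm (R.root θ) (R.root θ) := by
  have : Nonempty ι := ⟨θ⟩
  refine le_antisymm (ciInf_le (Set.finite_range _).bddBelow θ) (le_ciInf fun j => ?_)
  obtain ⟨n, hn, h⟩ := rootForm_theta_dvd hθ j
  have : (1 : ℝ) ≤ n := by exact_mod_cast hn
  have hq := rootForm_root_pos (R := R) θ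
  rw [h]
  nlinarith

lemma kap_theta [R.IsIrreducible] (hθ : IsTheta Δ t θ) : kap R t θ = 1 := by
  cases t
  · rfl
  · rw [kap, nu, iInf_rootForm_eq_theta hθ]
    exact div_self (rootForm_root_pos θ).ne'

lemma exists_nat_kap [R.IsIrreducible] (hθ : IsTheta Δ t θ) (i : ι) : ∃ n : ℕ, kap R t i = n := by
  cases t
  · exact ⟨1, by simp [kap]⟩
  · obtain ⟨n, hn, h⟩ := rootForm_theta_dvd hθ i
    refine ⟨n, ?_⟩
    rw [kap, nu, iInf_rootForm_eq_theta hθ, h]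
    exact mul_div_cancel_right₀ _ (rootForm_root_pos θ).ne'

/-- A positive imaginary part is at least `κ_j`, so this bound keeps it nonnegative under `s_0`. -/
lemma neg_kap_le_pairing_theta [R.IsIrreducible] (hθ : IsTheta Δ t θ) {j : ι}
    (hj : R.root j ≠ -R.root θ) : -kap R t j ≤ R.pairing j θ := by
  cases t
  · exact neg_one_le_pairing_of_maximal _ (rhoForm_pos Δ .untwisted) hθ hj
  · have h := neg_one_le_pairing_theta_twisted hθ hj
    have h₂ := pairing_mul_nu (R := R) j θ
    have h₃ := kap_theta hθ
    have h₄ := nu_pos (R := R) j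
    rw [kap] at h₃ ⊢
    rw [h₃, mul_one] at h₂
    rw [h₂]
    nlinarith

/-- A functional that is nonnegative on the simple roots is at most `κ_α θ` on `α`. -/
lemma apply_root_le_kap_mul_theta [R.IsIrreducible] (hθ : IsTheta Δ t θ) (f : M →ₗ[ℝ] ℝ)
    (hf : ∀ i ∈ Δ.support, 0 ≤ f (R.root i)) (j : ι) :
    f (R.root j) ≤ kap R t j * f (R.root θ) := by
  cases t
  · have := apply_nonneg_of_mem_closure f (by rintro _ ⟨i, hi, rfl⟩; exact hf i hi) (hθ j)
    rw [map_sub] at this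
    rw [kap]; linarith
  -- Maximality now compares coroots; rescaling by squared lengths produces the factor `ν_j`.
  · have := apply_nonneg_of_mem_closure (dualForm R f)
      (by
        rintro _ ⟨i, hi, rfl⟩
        rw [dualForm_coroot]
        have := rootForm_root_pos (R := R) i
        have := hf i hi
        positivity) (hθ j)
    rw [map_sub, dualForm_coroot, dualForm_coroot] at this
    have hj := rootForm_root_pos (R := R) j
    have hq := rootForm_root_pos (R := R) θ
    rw [kap, nu, iInf_rootForm_eq_theta hθ]
    rw [div_mul_eq_mul_div, div_mul_eq_mul_div, sub_nonneg, div_le_div_iff₀ hj hq] at this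
    rw [div_mul_eq_mul_div, le_div_iff₀ hq]
    linarith

end Theta

end

end DagPoly

namespace DagPoly

open RootPairing

noncomputable section

variable {ι M N : Type*} [Fintype ι] [AddCommGroup M] [Module ℝ M] [AddCommGroup N] [Module ℝ N]
  {R : RootPairing ι ℝ M N}

/-! ### Affine roots -/

/-- `[α_i, ζ]` is an affine root when `ζ` is an integral multiple of `κ_i`. -/
def IsAffRoot (R : RootPairing ι ℝ M N) (t : AffineType) (a : ι × ℝ) : Prop :=
  ∃ n : ℤ, a.2 = n * kap R t a.1

/-- The automorphisms of `ℝⁿ × ℝ` that act on the first component by an element of the Weyl group,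
fix the imaginary root, and permute the affine roots. -/
def affAut (R : RootPairing ι ℝ M N) (t : AffineType) : Subgroup ((M × ℝ) ≃ₗ[ℝ] (M × ℝ)) where
  carrier := {h | ∃ w : R.weylGroup, (∀ x, (h x).1 = w • x.1) ∧ h (0, 1) = (0, 1) ∧
    ∀ i, ∃ n : ℤ, (h (R.root i, 0)).2 = n * kap R t i}
  one_mem' := ⟨1, fun x => by simp, rfl, fun i => ⟨0, by simp⟩⟩
  mul_mem' := by
    rintro h k ⟨w, hw, hd, hi⟩ ⟨v, kv, kd, ki⟩
    refine ⟨w * v, fun x => by simp [hw, kv, mul_smul], by simp [hd, kd], fun i => ?_⟩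
    obtain ⟨n, hn⟩ := ki i
    obtain ⟨m, hm⟩ := hi (R.weylGroupToPerm v i)
    refine ⟨m + n, ?_⟩
    have : k (R.root i, 0) = (R.root (R.weylGroupToPerm v i), 0) + (n * kap R t i) • (0, 1) := by
      ext
      · simp [kv, weylGroup_apply_root]
      · simp [hn]
    rw [LinearEquiv.mul_apply, this, map_add, map_smul, hd, Prod.snd_add, hm, kap_perm]
    simp
    ring
  inv_mem' := by
    rintro h ⟨w, hw, hd, hi⟩
    have h1 : ∀ x, (h⁻¹ x).1 = w⁻¹ • x.1 := fun x => by
      rw [eq_inv_smul_iff, ← hw, ← LinearEquiv.mul_apply, mul_inv_cancel]; rfl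
    have h2 : h⁻¹ (0, 1) = (0, 1) := by
      conv_lhs => rw [← hd]
      rw [← LinearEquiv.mul_apply, inv_mul_cancel]; rfl
    refine ⟨w⁻¹, h1, h2, fun i => ?_⟩
    obtain ⟨n, hn⟩ := hi (R.weylGroupToPerm w⁻¹ i)
    refine ⟨-n, ?_⟩
    have e : h (R.root (R.weylGroupToPerm w⁻¹ i), 0) = (R.root i, 0) + (n * kap R t i) • (0, 1) := by
      ext
      · rw [hw, ← weylGroup_apply_root, smul_inv_smul]; simp
      · rw [hn, kap_perm]; simp
    have e' := congrArg (fun x => h⁻¹ x) e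
    beta_reduce at e'
    rw [← LinearEquiv.mul_apply, inv_mul_cancel, map_add, map_smul, h2] at e'
    have := congrArg Prod.snd e'
    change (0 : ℝ) = (h⁻¹ (R.root i, 0)).2 + (n * kap R t i) * 1 at this
    push_cast
    linarith

lemma affAut_apply_snd {t : AffineType} {h : (M × ℝ) ≃ₗ[ℝ] (M × ℝ)} (hh : h ∈ affAut R t) (z : M)
    (ζ : ℝ) : (h (z, ζ)).2 = (h (z, 0)).2 + ζ := by
  obtain ⟨w, -, hd, -⟩ := hh
  have : ((z, ζ) : M × ℝ) = (z, 0) + ζ • (0, 1) := by ext <;> simp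
  rw [this, map_add, map_smul, hd]
  simp

lemma affAut_apply_affVec {t : AffineType} {h : (M × ℝ) ≃ₗ[ℝ] (M × ℝ)} (hh : h ∈ affAut R t)
    {a : ι × ℝ} (ha : IsAffRoot R t a) :
    ∃ b, IsAffRoot R t b ∧ h (affVec R a) = affVec R b ∧
      ∀ x, R.coroot' b.1 (h x).1 = R.coroot' a.1 x.1 := by
  have hh' := hh
  obtain ⟨w, hw, -, hi⟩ := hh'
  obtain ⟨n, hn⟩ := hi a.1
  obtain ⟨m, hm⟩ := ha
  refine ⟨(R.weylGroupToPerm w a.1, (h (affVec R a)).2), ⟨n + m, ?_⟩, ?_, fun x => ?_⟩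
  · simp only [affVec]
    rw [affAut_apply_snd hh, hn, hm, kap_perm]
    push_cast; ring
  · ext
    · simp [affVec, hw, weylGroup_apply_root]
    · simp [affVec]
  · rw [hw, coroot'_perm_smul]

lemma affRefl_apply (a : ι × ℝ) (x : M × ℝ) :
    affRefl R a x = x - R.coroot' a.1 x.1 • affVec R a := rfl

lemma affRefl_apply_fst (a : ι × ℝ) (x : M × ℝ) :
    (affRefl R a x).1 = weylGroup.ofIdx R a.1 • x.1 := rfl

lemma affRefl_mul_self (a : ι × ℝ) : affRefl R a * affRefl R a = 1 := by
  ext1 x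
  exact Module.involutive_reflection _ x

lemma affRefl_affRefl (a : ι × ℝ) (x : M × ℝ) : affRefl R a (affRefl R a x) = x :=
  Module.involutive_reflection _ x

lemma affRefl_affVec_self (a : ι × ℝ) : affRefl R a (affVec R a) = -affVec R a :=
  Module.reflection_apply_self _

lemma affRefl_eq_self {a : ι × ℝ} {x : M × ℝ} (h : R.coroot' a.1 x.1 = 0) :
    affRefl R a x = x := by
  rw [affRefl_apply, h, zero_smul, sub_zero]

lemma coroot'_affRefl_self (a : ι × ℝ) (x : M × ℝ) :
    R.coroot' a.1 (affRefl R a x).1 = -R.coroot' a.1 x.1 := by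
  change R.coroot' a.1 (R.reflection a.1 x.1) = _
  rw [coroot'_reflection, coroot'_reflectionPerm_self]

lemma affRefl_mem_affAut [R.IsCrystallographic] {t : AffineType} {a : ι × ℝ}
    (ha : IsAffRoot R t a) : affRefl R a ∈ affAut R t := by
  refine ⟨weylGroup.ofIdx R a.1, affRefl_apply_fst a, affRefl_eq_self (by simp), fun i => ?_⟩
  obtain ⟨n, hn⟩ := ha
  obtain ⟨m, hm⟩ := exists_int_pairing_mul_kap (R := R) t i a.1
  refine ⟨-(n * m), ?_⟩
  rw [affRefl_apply]
  simp only [affVec, root_coroot'_eq_pairing, hn, Prod.smul_mk, Prod.mk_sub_mk, smul_eq_mul]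
  push_cast
  linear_combination (-(n : ℝ)) * hm

lemma finAct_apply (w : R.weylGroup) (x : M × ℝ) : finAct R w x = (w • x.1, x.2) := rfl

lemma finAct_mem_affAut {t : AffineType} (w : R.weylGroup) : finAct R w ∈ affAut R t :=
  ⟨w, fun _ => rfl, by simp [finAct_apply], fun i => ⟨0, by simp [finAct_apply]⟩⟩

lemma transl_rhoCheck_mem_affAut [R.IsCrystallographic] [R.IsReduced] (Δ : R.Base)
    (t : AffineType) : transl R (rhoCheck Δ t) ∈ affAut R t := by
  refine ⟨1, fun x => by simp [transl], by simp [transl], fun i => ?_⟩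
  obtain ⟨n, hn⟩ := exists_int_rhoForm_root Δ t i
  refine ⟨-n, ?_⟩
  change 0 - rhoForm Δ t (R.root i) = _
  rw [hn]; push_cast; ring

/-- The linear functional whose sign on an affine root is the sign of that root. -/
def affHt (Δ : R.Base) (t : AffineType) : M × ℝ →ₗ[ℝ] ℝ :=
  (1 + ∑ i, |rhoForm Δ t (R.root i)| / kap R t i) • LinearMap.snd ℝ M ℝ +
    rhoForm Δ t ∘ₗ LinearMap.fst ℝ M ℝ

/-- Positive affine roots. -/
def AffPos (Δ : R.Base) (a : ι × ℝ) : Prop := 0 < a.2 ∨ (a.2 = 0 ∧ Δ.IsPos a.1)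

/-! ### Words -/

variable {κ : Type*}

/-- The product of the reflections of a word. -/
def wordProd (R : RootPairing ι ℝ M N) (a : κ → ι × ℝ) (l : List κ) : (M × ℝ) ≃ₗ[ℝ] (M × ℝ) :=
  (l.map fun p => affRefl R (a p)).prod

lemma wordProd_nil (a : κ → ι × ℝ) : wordProd R a [] = 1 := rfl

lemma wordProd_cons (a : κ → ι × ℝ) (p : κ) (l : List κ) :
    wordProd R a (p :: l) = affRefl R (a p) * wordProd R a l := by
  simp [wordProd]

lemma wordProd_append (a : κ → ι × ℝ) (l₁ l₂ : List κ) :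
    wordProd R a (l₁ ++ l₂) = wordProd R a l₁ * wordProd R a l₂ := by
  simp [wordProd]

/-! ### The sign of an affine root -/

section Sign

variable [R.IsCrystallographic] [R.IsReduced] {Δ : R.Base} {t : AffineType}

/-- A positive imaginary part is at least `κ_α`, and the weight `1 + ∑ |ρ̌(α_i)| / κ_i` in `affHt`
is chosen so that `κ_α` already outweighs the finite part. -/
lemma affHt_pos_of_pos {a : ι × ℝ} (ha : IsAffRoot R t a) (h : 0 < a.2) :
    0 < affHt Δ t (affVec R a) := by
  obtain ⟨n, hn⟩ := ha
  have hk := kap_pos (R := R) t a.1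
  have hn1 : (1 : ℝ) ≤ n := by
    rw [hn] at h
    have : (0 : ℝ) < n := pos_of_mul_pos_left h hk.le
    exact_mod_cast this
  have h₁ : |rhoForm Δ t (R.root a.1)| / kap R t a.1 ≤
      ∑ i, |rhoForm Δ t (R.root i)| / kap R t i :=
    Finset.single_le_sum (f := fun i => |rhoForm Δ t (R.root i)| / kap R t i)
      (fun i _ => div_nonneg (abs_nonneg _) (kap_pos t i).le) (Finset.mem_univ a.1)
  rw [div_le_iff₀ hk] at h₁
  simp only [affHt, affVec, LinearMap.add_apply, LinearMap.smul_apply, LinearMap.snd_apply,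
    LinearMap.comp_apply, LinearMap.fst_apply, smul_eq_mul, hn]
  set S := ∑ i, |rhoForm Δ t (R.root i)| / kap R t i
  have hS : 0 ≤ S := Finset.sum_nonneg fun i _ => div_nonneg (abs_nonneg _) (kap_pos t i).le
  have h₂ := neg_abs_le (rhoForm Δ t (R.root a.1))
  have h₃ : (1 + S) * kap R t a.1 ≤ (1 + S) * (n * kap R t a.1) := by
    apply mul_le_mul_of_nonneg_left _ (by positivity)
    nlinarith
  nlinarith

lemma affHt_of_snd_eq_zero {a : ι × ℝ} (h : a.2 = 0) :
    affHt Δ t (affVec R a) = rhoForm Δ t (R.root a.1) := by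
  simp [affHt, affVec, h]

lemma affVec_neg (a : ι × ℝ) : affVec R (R.reflectionPerm a.1 a.1, -a.2) = -affVec R a := by
  rw [affVec, affVec, root_reflectionPerm_self]; rfl

lemma IsAffRoot.neg {a : ι × ℝ} (ha : IsAffRoot R t a) :
    IsAffRoot R t (R.reflectionPerm a.1 a.1, -a.2) := by
  obtain ⟨n, hn⟩ := ha
  exact ⟨-n, by simp only [hn, kap_reflectionPerm]; push_cast; ring⟩

lemma affHt_pos_iff {a : ι × ℝ} (ha : IsAffRoot R t a) :
    0 < affHt Δ t (affVec R a) ↔ AffPos Δ a := by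
  rcases lt_trichotomy a.2 0 with h | h | h
  · have h₁ := affHt_pos_of_pos (Δ := Δ) ha.neg (by simpa using h)
    rw [affVec_neg, map_neg] at h₁
    simp only [AffPos, h.not_gt, h.ne, false_and, or_self, iff_false]
    linarith
  · rw [affHt_of_snd_eq_zero h, rhoForm_root_pos_iff]
    simp [AffPos, h]
  · simp [AffPos, h, affHt_pos_of_pos ha h]

lemma affHt_ne_zero {a : ι × ℝ} (ha : IsAffRoot R t a) : affHt Δ t (affVec R a) ≠ 0 := by
  intro h0
  have h₁ := (affHt_pos_iff (Δ := Δ) ha).not.1 h0.not_gt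
  have h₂ := (affHt_pos_iff (Δ := Δ) ha.neg).not.1 (by rw [affVec_neg, map_neg, h0]; simp)
  simp only [AffPos, isPos_neg_iff, neg_pos, neg_eq_zero] at h₁ h₂
  have := lt_trichotomy a.2 0
  tauto

/-- A family of affine roots whose reflections permute the other positive affine roots. -/
structure IsSimpleFamily (Δ : R.Base) (t : AffineType) (a : κ → ι × ℝ) : Prop where
  isAffRoot p : IsAffRoot R t (a p)
  affHt_pos p : 0 < affHt Δ t (affVec R (a p))
  affHt_affRefl_pos p b : IsAffRoot R t b → 0 < affHt Δ t (affVec R b) → b ≠ a p →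
    0 < affHt Δ t (affRefl R (a p) (affVec R b))

lemma affRefl_affVec (a b : ι × ℝ) : affRefl R a (affVec R b) =
    affVec R (R.reflectionPerm a.1 b.1, b.2 - R.pairing b.1 a.1 * a.2) := by
  rw [affRefl_apply]
  ext <;> simp [affVec, reflection_apply_root]

lemma IsAffRoot.affRefl {a b : ι × ℝ} (ha : IsAffRoot R t a) (hb : IsAffRoot R t b) :
    IsAffRoot R t (R.reflectionPerm a.1 b.1, b.2 - R.pairing b.1 a.1 * a.2) := by
  obtain ⟨n, hn⟩ := ha
  obtain ⟨k, hk⟩ := hb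
  obtain ⟨m, hm⟩ := exists_int_pairing_mul_kap (R := R) t b.1 a.1
  refine ⟨k - n * m, ?_⟩
  simp only [hn, hk, kap_reflectionPerm]
  push_cast
  linear_combination (-(n : ℝ)) * hm

lemma affHt_affRefl_pos_of_finite {i : ι} (hi : i ∈ Δ.support) {b : ι × ℝ}
    (hb : IsAffRoot R t b) (hpos : 0 < affHt Δ t (affVec R b)) (hne : b ≠ (i, 0)) :
    0 < affHt Δ t (affRefl R (i, 0) (affVec R b)) := by
  have hi' : IsAffRoot R t (i, 0) := ⟨0, by simp⟩
  rw [affRefl_affVec, affHt_pos_iff (hi'.affRefl hb)]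
  rw [affHt_pos_iff hb] at hpos
  rcases hpos with h | ⟨h, hp⟩
  · left; simpa using h
  · right
    refine ⟨by simpa using h, hp.reflectionPerm hi fun h' => hne ?_⟩
    ext
    exacts [h', h]

/-- Viewing finite simple roots as affine ones lets a single exchange argument serve both `W` and
the affine group. -/
lemma isSimpleFamily_finite (Δ : R.Base) (t : AffineType) :
    IsSimpleFamily Δ t (fun i : Δ.support => ((i : ι), (0 : ℝ))) where
  isAffRoot p := ⟨0, by simp⟩
  affHt_pos p := by
    rw [affHt_of_snd_eq_zero rfl, rhoForm_root_pos_iff]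
    exact Base.isPos_of_mem_support p.2
  affHt_affRefl_pos p b hb h hne := affHt_affRefl_pos_of_finite p.2 hb h hne

lemma isSimpleFamily_affine [R.IsRootSystem] [R.IsIrreducible] {θ : ι} (hθ : IsTheta Δ t θ) :
    IsSimpleFamily Δ t (simpleAff Δ θ) := by
  have h0 : IsAffRoot R t (R.reflectionPerm θ θ, 1) :=
    ⟨1, by simp only [kap_reflectionPerm, kap_theta hθ]; simp⟩
  refine ⟨?_, ?_, ?_⟩
  · rintro (_ | p)
    exacts [h0, ⟨0, by simp [simpleAff]⟩]
  · rintro (_ | p)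
    · exact affHt_pos_of_pos h0 one_pos
    · exact (isSimpleFamily_finite Δ t).affHt_pos p
  · rintro (_ | p) b hb hpos hne
    swap
    · exact affHt_affRefl_pos_of_finite p.2 hb hpos hne
    simp only [simpleAff] at hne ⊢
    rw [affRefl_affVec, affHt_pos_iff (h0.affRefl hb)]
    rw [affHt_pos_iff hb] at hpos
    have hs : R.reflectionPerm (R.reflectionPerm θ θ) b.1 = R.reflectionPerm θ b.1 := by
      apply R.root.injective
      rw [root_reflectionPerm, root_reflectionPerm, reflection_apply, reflection_apply,
        coroot'_reflectionPerm_self, root_reflectionPerm_self]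
      simp
    simp only [AffPos, pairing_reflectionPerm_self_right, mul_one, sub_neg_eq_add, hs]
    have hk := kap_pos (R := R) t b.1
    -- The roots `[-θ, n]` go to `[θ, n - 2]`; `n = 1` is `α₀` itself, so `n ≥ 2`.
    by_cases hbθ : R.root b.1 = -R.root θ
    · rw [← root_reflectionPerm_self] at hbθ
      have hb1 := R.root.injective hbθ
      have hkb : kap R t b.1 = 1 := by rw [hb1, kap_reflectionPerm, kap_theta hθ]
      obtain ⟨n, hn⟩ := hb
      rw [hkb, mul_one] at hn
      have hnp : ¬ Δ.IsPos b.1 := by rw [hb1, isPos_neg_iff, not_not]; exact isPos_theta hθ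
      have hn0 : (0 : ℝ) < n := by
        rcases hpos with h | h
        · rwa [hn] at h
        · exact absurd h.2 hnp
      have hn1 : n ≠ 1 := fun h => hne (by ext; exacts [hb1, by simp [hn, h]])
      have hn2 : 2 ≤ n := by
        have : 0 < n := by exact_mod_cast hn0
        omega
      have hn3 : (2 : ℝ) ≤ n := by exact_mod_cast hn2
      have e : R.reflectionPerm θ b.1 = θ := by rw [hb1, reflectionPerm_self]
      rw [e, hb1, pairing_reflectionPerm_self_left, pairing_same, hn]
      rcases hn3.lt_or_eq with h | h
      · left; linarith
      · right; exact ⟨by linarith, isPos_theta hθ⟩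
    have hp := neg_kap_le_pairing_theta hθ hbθ
    rcases hpos with h | ⟨h, hbp⟩
    · have hb2 : kap R t b.1 ≤ b.2 := by
        obtain ⟨n, hn⟩ := hb
        rw [hn] at h ⊢
        have : (0 : ℝ) < n := pos_of_mul_pos_left h hk.le
        have : (1 : ℝ) ≤ n := by exact_mod_cast this
        nlinarith
      rcases (show 0 ≤ b.2 + R.pairing b.1 θ by linarith).lt_or_eq with h' | h'
      · exact .inl h'
      · right
        refine ⟨h'.symm, ?_⟩
        -- Equality forces `(β, θ^∨) < 0`, while a negative `s_θ β` would give `(β, θ^∨) ≥ 0`.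
        by_contra hc
        rw [← isPos_neg_iff] at hc
        have := pairing_theta_nonneg hθ hc
        rw [pairing_reflectionPerm_self_left, ← pairing_reflectionPerm,
          pairing_reflectionPerm_self_right] at this
        linarith
    · have hp' := pairing_theta_nonneg hθ hbp
      rcases hp'.lt_or_eq with h' | h'
      · left; linarith
      · right
        refine ⟨by linarith, ?_⟩
        rwa [reflectionPerm_eq_of_pairing_eq_zero h'.symm]

/-- A functional that is nonnegative on the simple affine roots is nonnegative on the positive
ones. -/
lemma apply_affVec_nonneg [R.IsRootSystem] [R.IsIrreducible] {θ : ι} (hθ : IsTheta Δ t θ)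
    (f : M × ℝ →ₗ[ℝ] ℝ) (hf : ∀ p, 0 ≤ f (affVec R (simpleAff Δ θ p))) {b : ι × ℝ}
    (hb : IsAffRoot R t b) (hpos : AffPos Δ b) : 0 ≤ f (affVec R b) := by
  set f₁ : M →ₗ[ℝ] ℝ := f ∘ₗ LinearMap.inl ℝ M ℝ with hf₁
  have hf₁s : ∀ i ∈ Δ.support, 0 ≤ f₁ (R.root i) := fun i hi => hf (some ⟨i, hi⟩)
  have hdec : ∀ a : ι × ℝ, f (affVec R a) = f₁ (R.root a.1) + a.2 * f (0, 1) := fun a => by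
    have : affVec R a = (R.root a.1, 0) + a.2 • (0, 1) := by ext <;> simp [affVec]
    rw [this, map_add, map_smul]; rfl
  have h0 := hf none
  have hθ' := apply_root_nonneg_of_isPos f₁ hf₁s (isPos_theta hθ)
  rw [hdec] at h0 ⊢
  simp only [simpleAff, root_reflectionPerm_self, map_neg, one_mul] at h0
  rcases hpos with h | ⟨h, hbp⟩
  · obtain ⟨n, hn⟩ := hb
    have hk := kap_pos (R := R) t b.1
    have hb2 : kap R t b.1 ≤ b.2 := by
      rw [hn] at h ⊢
      have : (0 : ℝ) < n := pos_of_mul_pos_left h hk.le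
      have : (1 : ℝ) ≤ n := by exact_mod_cast this
      nlinarith
    -- Nonnegativity on `α₀` says `f (0, 1) ≥ f₁ θ`, so the imaginary part, at least `κ`,
    -- compensates a negative `f₁ α ≥ -κ f₁ θ`.
    have := apply_root_le_kap_mul_theta hθ f₁ hf₁s (R.reflectionPerm b.1 b.1)
    rw [root_reflectionPerm_self, map_neg, kap_reflectionPerm] at this
    nlinarith
  · rw [h, zero_mul, add_zero]
    exact apply_root_nonneg_of_isPos f₁ hf₁s hbp

/-! ### The exchange property -/

lemma wordProd_mem_affAut {a : κ → ι × ℝ} (ha : ∀ p, IsAffRoot R t (a p)) (l : List κ) :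
    wordProd R a l ∈ affAut R t := by
  refine Subgroup.list_prod_mem _ fun h hh => ?_
  obtain ⟨p, -, rfl⟩ := List.mem_map.1 hh
  exact affRefl_mem_affAut (ha p)

lemma mul_affRefl_eq {h : (M × ℝ) ≃ₗ[ℝ] (M × ℝ)} (hh : h ∈ affAut R t) {a b : ι × ℝ}
    (ha : IsAffRoot R t a) (hab : h (affVec R a) = affVec R b) :
    h * affRefl R a = affRefl R b * h := by
  obtain ⟨c, -, hc, hx⟩ := affAut_apply_affVec hh ha
  have hbc : b = c := by
    have := hab.symm.trans hc
    simp only [affVec, Prod.mk.injEq, EmbeddingLike.apply_eq_iff_eq] at this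
    exact Prod.ext this.1 this.2
  subst hbc
  ext1 x
  rw [LinearEquiv.mul_apply, LinearEquiv.mul_apply, affRefl_apply, affRefl_apply, map_sub,
    map_smul, hab, hx]

/-- Apply the letters to `a p` from right to left. At the letter `k` where the sign first changes,
the root must be `a k`, the only positive root made negative by that reflection; conjugation then
cancels this letter against `p`. -/
lemma IsSimpleFamily.exchange {a : κ → ι × ℝ} (ha : IsSimpleFamily Δ t a) (l : List κ) (p : κ)
    (h : affHt Δ t (wordProd R a l (affVec R (a p))) < 0) :
    ∃ l' : List κ, l'.length + 1 = l.length ∧ wordProd R a l' = wordProd R a l * affRefl R (a p) := by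
  induction l with
  | nil => exact absurd (ha.affHt_pos p) (not_lt.2 h.le)
  | cons k l ih =>
    by_cases h' : affHt Δ t (wordProd R a l (affVec R (a p))) < 0
    · obtain ⟨l', hl, e⟩ := ih h'
      exact ⟨k :: l', by simp [hl], by rw [wordProd_cons, wordProd_cons, e, mul_assoc]⟩
    have hm := wordProd_mem_affAut ha.isAffRoot l
    obtain ⟨b, hb, hb', -⟩ := affAut_apply_affVec hm (ha.isAffRoot p)
    have hbk : b = a k := by
      by_contra hne
      refine absurd (ha.affHt_affRefl_pos k b hb ?_ hne) ?_
      · rw [← hb']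
        exact lt_of_le_of_ne (not_lt.1 h') (by rw [hb']; exact (affHt_ne_zero hb).symm)
      · rw [← hb']
        rw [wordProd_cons, LinearEquiv.mul_apply] at h
        exact h.not_gt
    subst hbk
    refine ⟨l, rfl, ?_⟩
    rw [wordProd_cons, mul_assoc, mul_affRefl_eq hm (ha.isAffRoot p) hb', ← mul_assoc,
      affRefl_mul_self, one_mul]

/-- Every simple reflection of the word increases the length. -/
def IsReducedWord (Δ : R.Base) (t : AffineType) (a : κ → ι × ℝ) (l : List κ) : Prop :=
  ∀ l₁ p l₂, l = l₁ ++ p :: l₂ → 0 < affHt Δ t (wordProd R a l₁ (affVec R (a p)))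

/-- At a letter violating the sign condition, exchange deletes it together with an earlier letter,
shortening the word by two. -/
lemma IsSimpleFamily.isReducedWord {a : κ → ι × ℝ} (ha : IsSimpleFamily Δ t a) {l : List κ}
    (hl : ∀ l', wordProd R a l' = wordProd R a l → l.length ≤ l'.length) :
    IsReducedWord Δ t a l := by
  rintro l₁ p l₂ rfl
  by_contra hc
  obtain ⟨b, hb, hb', -⟩ := affAut_apply_affVec (wordProd_mem_affAut ha.isAffRoot l₁)
    (ha.isAffRoot p)
  have hneg := lt_of_le_of_ne (not_lt.1 hc) (by rw [hb']; exact affHt_ne_zero hb)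
  obtain ⟨l', hlen, e⟩ := ha.exchange l₁ p hneg
  have := hl (l' ++ l₂) (by rw [wordProd_append, wordProd_append, wordProd_cons, e, mul_assoc])
  simp at this
  omega

end Sign

/-! ### Dominant elements -/

section Dominant

variable {Δ : R.Base}

/-- The element of the Weyl group of a word in the simple reflections. -/
def finWord (Δ : R.Base) (l : List Δ.support) : R.weylGroup :=
  (l.map fun i => weylGroup.ofIdx R (i : ι)).prod

lemma finWord_append (l₁ l₂ : List Δ.support) :
    finWord Δ (l₁ ++ l₂) = finWord Δ l₁ * finWord Δ l₂ := by
  simp [finWord]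

lemma finWord_cons (i : Δ.support) (l : List Δ.support) :
    finWord Δ (i :: l) = weylGroup.ofIdx R (i : ι) * finWord Δ l := by
  simp [finWord]

lemma wordProd_finite_apply (l : List Δ.support) (x : M × ℝ) :
    wordProd R (fun i : Δ.support => ((i : ι), (0 : ℝ))) l x = (finWord Δ l • x.1, x.2) := by
  induction l with
  | nil => simp [wordProd, finWord]
  | cons i l ih =>
    rw [wordProd_cons, LinearEquiv.mul_apply, ih, finWord_cons, mul_smul]
    ext
    · rw [affRefl_apply_fst]
    · simp [affRefl_apply, affVec]

variable [R.IsCrystallographic] [R.IsReduced]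

lemma exists_finWord_smul (Δ : R.Base) (w : R.weylGroup) :
    ∃ l : List Δ.support, ∀ x : M, w • x = finWord Δ l • x := by
  obtain ⟨w, hw⟩ := w
  induction hw using weylGroup.induction with
  | one => exact ⟨[], fun x => rfl⟩
  | mul g₁ g₂ hg₁ hg₂ h₁ h₂ =>
    obtain ⟨l₁, h₁⟩ := h₁
    obtain ⟨l₂, h₂⟩ := h₂
    refine ⟨l₁ ++ l₂, fun x => ?_⟩
    rw [← Submonoid.mk_mul_mk _ _ _ hg₁ hg₂, mul_smul, finWord_append, mul_smul]
    exact (h₁ _).trans (congrArg _ (h₂ _))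
  | mem i =>
    change ∃ l : List Δ.support, ∀ x : M, R.reflection i x = finWord Δ l • x
    refine Base.induction_reflect (b := Δ) i
      (p := fun i => ∃ l : List Δ.support, ∀ x : M, R.reflection i x = finWord Δ l • x) ?_ ?_ ?_
    · rintro i ⟨l, hl⟩
      refine ⟨l, fun x => ?_⟩
      rw [← hl, reflection_apply, reflection_apply, coroot'_reflectionPerm_self,
        root_reflectionPerm_self]
      simp
    · exact fun i hi => ⟨[⟨i, hi⟩], fun x => by simp [finWord]⟩
    · rintro i j ⟨l, hl⟩ hj
      refine ⟨⟨j, hj⟩ :: (l ++ [⟨j, hj⟩]), fun x => ?_⟩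
      rw [finWord_cons, finWord_append, mul_smul, mul_smul, reflection_reflectionPerm]
      simp only [LinearEquiv.mul_apply, hl]
      simp [finWord]

/-- Induction on the length. If the word sends its last simple root to a positive root, exchange
shortens it; otherwise dominance at both ends forces `x`, hence `y`, onto the wall of that root, and
the last letter acts trivially. The second point `y` is carried along so that stabilizers can be
compared. -/
lemma finWord_smul_eq_of_dominant {x y : M} (hx : ∀ i ∈ Δ.support, 0 ≤ R.coroot' i x)
    (hxy : ∀ i ∈ Δ.support, R.coroot' i x = 0 → R.coroot' i y = 0) (l : List Δ.support)
    (hl : ∀ i ∈ Δ.support, 0 ≤ R.coroot' i (finWord Δ l • x)) : finWord Δ l • y = y := by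
  induction h : l.length using Nat.strong_induction_on generalizing l with
  | _ n ih =>
    subst h
    rcases l.eq_nil_or_concat with rfl | ⟨l, p, rfl⟩
    · simp [finWord]
    rw [List.concat_eq_append] at ih hl ⊢
    have hap : ∀ z : M, finWord Δ (l ++ [p]) • z = finWord Δ l • R.reflection p z := fun z => by
      rw [finWord_append, mul_smul]; simp [finWord]
    have hperm : R.weylGroupToPerm (finWord Δ (l ++ [p])) p =
        R.weylGroupToPerm (finWord Δ l) (R.reflectionPerm p p) := by
      apply R.root.injective
      rw [← weylGroup_apply_root, hap, ← root_reflectionPerm, weylGroup_apply_root]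
    by_cases hp : Δ.IsPos (R.weylGroupToPerm (finWord Δ (l ++ [p])) p)
    · rw [hperm, perm_reflectionPerm_self, isPos_neg_iff] at hp
      obtain ⟨l', hlen, e⟩ := (isSimpleFamily_finite Δ .untwisted).exchange l p (by
        have hn := rhoForm_root_pos .untwisted ((isPos_neg_iff Δ _).2 hp)
        rw [root_reflectionPerm_self, map_neg] at hn
        rw [wordProd_finite_apply]
        have := affHt_of_snd_eq_zero (Δ := Δ) (t := .untwisted)
          (a := (R.weylGroupToPerm (finWord Δ l) p, 0)) rfl
        simp only [affVec] at this ⊢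
        rw [weylGroup_apply_root, this]
        linarith)
      have key : ∀ z : M, finWord Δ (l ++ [p]) • z = finWord Δ l' • z := fun z => by
        have := congrArg Prod.fst (LinearEquiv.congr_fun e (z, 0))
        rw [LinearEquiv.mul_apply, wordProd_finite_apply, wordProd_finite_apply,
          affRefl_apply_fst] at this
        exact (hap z).trans this.symm
      rw [key]
      exact ih l'.length (by simp; omega) l' (fun i hi => by rw [← key]; exact hl i hi) rfl
    · have h₀ : R.coroot' p x = 0 := by
        refine le_antisymm ?_ (hx p p.2)
        rw [← isPos_neg_iff] at hp
        have := coroot'_nonneg_of_isPos hl hp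
        rw [coroot'_reflectionPerm_self, coroot'_perm_smul] at this
        linarith
      have hfx : R.reflection p x = x := by rw [reflection_apply, h₀]; simp
      have hfy : R.reflection p y = y := by rw [reflection_apply, hxy p p.2 h₀]; simp
      rw [hap, hfx] at hl
      rw [hap, hfy]
      exact ih l.length (by simp) l hl rfl

/-- If `x` and `w x` are dominant, then `w` fixes `x`, and also every dominant element with the
same or more vanishing simple coroots. -/
lemma smul_eq_of_dominant {x y : M} (hx : ∀ i ∈ Δ.support, 0 ≤ R.coroot' i x)
    (hxy : ∀ i ∈ Δ.support, R.coroot' i x = 0 → R.coroot' i y = 0) (w : R.weylGroup)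
    (hw : ∀ i ∈ Δ.support, 0 ≤ R.coroot' i (w • x)) : w • y = y := by
  obtain ⟨l, hl⟩ := exists_finWord_smul Δ w
  rw [hl]
  exact finWord_smul_eq_of_dominant hx hxy l fun i hi => by rw [← hl]; exact hw i hi

end Dominant

end

end DagPoly

namespace DagPoly

open RootPairing

noncomputable section

variable {ι M N : Type*} [Fintype ι] [AddCommGroup M] [Module ℝ M] [AddCommGroup N] [Module ℝ N]
  {R : RootPairing ι ℝ M N}

/-! ### The operators as pullbacks -/

/-- The operator `natOp R a` is the pullback of coefficients along this map. -/
def pull (R : RootPairing ι ℝ M N) (a : ι × ℝ) (y : M × ℝ) : M × ℝ :=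
  if 0 < R.coroot' a.1 y.1 then affRefl R a y else y

lemma pull_of_nonneg {a : ι × ℝ} {y : M × ℝ} (h : 0 ≤ R.coroot' a.1 y.1) :
    pull R a y = affRefl R a y := by
  rcases h.lt_or_eq with h | h
  · exact if_pos h
  · rw [pull, if_neg h.symm.le.not_gt, affRefl_eq_self h.symm]

lemma pull_of_nonpos {a : ι × ℝ} {y : M × ℝ} (h : R.coroot' a.1 y.1 ≤ 0) : pull R a y = y :=
  if_neg h.not_gt

lemma coroot'_pull_nonpos (a : ι × ℝ) (y : M × ℝ) : R.coroot' a.1 (pull R a y).1 ≤ 0 := by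
  rw [pull]
  split_ifs with h
  · rw [coroot'_affRefl_self]; linarith
  · exact not_lt.1 h

lemma linExt_single (g : M × ℝ → QPoly M) (x : M × ℝ) (c : ℤ) :
    linExt g (AddMonoidAlgebra.single x c) = c • g x := by
  change Finsupp.liftAddHom (fun x => (smulAddHom ℤ (QPoly M)).flip (g x))
    (Finsupp.single x c) = _
  rw [Finsupp.liftAddHom_apply_single]
  rfl

lemma coeff_mono (x y : M × ℝ) [Decidable (x = y)] :
    (mono x).coeff y = if x = y then 1 else 0 := by
  rw [mono, AddMonoidAlgebra.coeff_single, Finsupp.single_apply]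

lemma coeff_linExt_of_coeff_mono {g : M × ℝ → QPoly M} {φ : M × ℝ → M × ℝ}
    (h : ∀ x y, (g x).coeff y = (mono x).coeff (φ y)) (f : QPoly M) (y : M × ℝ) :
    (linExt g f).coeff y = f.coeff (φ y) := by
  classical
  induction f using AddMonoidAlgebra.induction_linear with
  | zero => simp
  | add f₁ f₂ h₁ h₂ => simp [h₁, h₂]
  | single x c =>
    rw [linExt_single, AddMonoidAlgebra.coeff_smul_apply, h, coeff_mono,
      AddMonoidAlgebra.coeff_single, Finsupp.single_apply]
    simp

/-- On the line of `y` and `s_a y` the operator copies the coefficient at the nonpositive end to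
both ends. -/
lemma coeff_natOp (a : ι × ℝ) (f : QPoly M) (y : M × ℝ) :
    (natOp R a f).coeff y = f.coeff (pull R a y) := by
  classical
  refine coeff_linExt_of_coeff_mono (fun x y => ?_) f y
  have hs : x = affRefl R a y ↔ affRefl R a x = y :=
    ⟨fun h => by rw [h, affRefl_affRefl], fun h => by rw [← h, affRefl_affRefl]⟩
  have hr := coroot'_affRefl_self (R := R) a x
  by_cases hy : 0 < R.coroot' a.1 y.1
  · rw [pull_of_nonneg hy.le]
    split_ifs with h₁ h₂
    · have : x ≠ y := by rintro rfl; linarith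
      simp [coeff_mono, hs, this]
    · have : x ≠ y := by rintro rfl; linarith
      simp [coeff_mono, hs, this, affRefl_eq_self h₂]
    · have : affRefl R a x ≠ y := by
        rintro rfl
        rw [hr] at hy
        exact h₁ (by linarith)
      simp [coeff_mono, hs, this]
  · rw [pull_of_nonpos (not_lt.1 hy)]
    split_ifs with h₁ h₂
    · have : affRefl R a x ≠ y := by rintro rfl; exact hy (by linarith)
      simp [coeff_mono, this]
    · rfl
    · have : x ≠ y := by
        rintro rfl
        exact hy (lt_of_le_of_ne (not_lt.1 h₁) (Ne.symm h₂))
      simp [coeff_mono, this]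

variable {κ : Type*}

/-- The pullback along the operators of a word. -/
def pullWord (R : RootPairing ι ℝ M N) (a : κ → ι × ℝ) (l : List κ) (y : M × ℝ) : M × ℝ :=
  l.foldl (fun y p => pull R (a p) y) y

lemma pullWord_append_singleton (a : κ → ι × ℝ) (l : List κ) (p : κ) (y : M × ℝ) :
    pullWord R a (l ++ [p]) y = pull R (a p) (pullWord R a l y) := by
  simp [pullWord]

lemma coeff_frakT {Δ : R.Base} {θ : ι} (g : (M × ℝ) ≃ₗ[ℝ] (M × ℝ)) (l : List (Option Δ.support))
    (f : QPoly M) (y : M × ℝ) :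
    (frakT Δ θ g l f).coeff y = f.coeff (pullWord R (simpleAff Δ θ) l (g⁻¹ y)) := by
  classical
  have hl : ∀ (l : List (Option Δ.support)) (y : M × ℝ),
      ((l.map fun p => natOp R (simpleAff Δ θ p)).prod f).coeff y =
        f.coeff (pullWord R (simpleAff Δ θ) l y) := by
    intro l
    induction l with
    | nil => intro y; rfl
    | cons p l ih =>
      intro y
      rw [List.map_cons, List.prod_cons]
      exact (coeff_natOp _ _ y).trans (ih _)
  refine Eq.trans (coeff_linExt_of_coeff_mono (φ := fun y => g⁻¹ y) (fun x y => ?_) _ y) (hl l _)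
  rw [coeff_mono, coeff_mono]
  refine if_congr ?_ rfl rfl
  constructor
  · rintro rfl
    rw [← LinearEquiv.mul_apply, inv_mul_cancel]; rfl
  · rintro rfl
    rw [← LinearEquiv.mul_apply, mul_inv_cancel]; rfl

/-! ### Additivity of the pullback on closed Weyl chambers -/

/-- Two points lie in a common closed Weyl chamber. -/
def SameChamber (R : RootPairing ι ℝ M N) (x y : M) : Prop :=
  ∀ i, 0 ≤ R.coroot' i x * R.coroot' i y

lemma SameChamber.smul {x y : M} (h : SameChamber R x y) (w : R.weylGroup) :
    SameChamber R (w • x) (w • y) := fun i => by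
  rw [coroot'_smul, coroot'_smul]
  exact h _

/-- The pairings of `x` and `y` with `a` have compatible signs, so both are reflected or both are
kept; a zero pairing fits either choice. -/
lemma SameChamber.pull {x y : M × ℝ} (h : SameChamber R x.1 y.1) (a : ι × ℝ) :
    ∃ w : R.weylGroup, (pull R a x).1 = w • x.1 ∧ (pull R a y).1 = w • y.1 ∧
      DagPoly.pull R a (x + y) = DagPoly.pull R a x + DagPoly.pull R a y := by
  have ha := h a.1
  by_cases hp : 0 < R.coroot' a.1 (x + y).1
  · have hp' := hp
    rw [Prod.fst_add, map_add] at hp'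
    have hx : 0 ≤ R.coroot' a.1 x.1 := by by_contra! hc; nlinarith
    have hy : 0 ≤ R.coroot' a.1 y.1 := by by_contra! hc; nlinarith
    refine ⟨weylGroup.ofIdx R a.1, ?_, ?_, ?_⟩
    · rw [pull_of_nonneg hx, affRefl_apply_fst]
    · rw [pull_of_nonneg hy, affRefl_apply_fst]
    · rw [pull_of_nonneg hx, pull_of_nonneg hy, pull_of_nonneg hp.le, map_add]
  · have hp' := not_lt.1 hp
    rw [Prod.fst_add, map_add] at hp'
    have hx : R.coroot' a.1 x.1 ≤ 0 := by by_contra! hc; nlinarith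
    have hy : R.coroot' a.1 y.1 ≤ 0 := by by_contra! hc; nlinarith
    refine ⟨1, ?_, ?_, ?_⟩
    · rw [pull_of_nonpos hx, one_smul]
    · rw [pull_of_nonpos hy, one_smul]
    · rw [pull_of_nonpos hx, pull_of_nonpos hy, pull_of_nonpos (not_lt.1 hp)]

lemma SameChamber.pullWord {x y : M × ℝ} (h : SameChamber R x.1 y.1) (a : κ → ι × ℝ)
    (l : List κ) :
    ∃ w : R.weylGroup, (pullWord R a l x).1 = w • x.1 ∧ (pullWord R a l y).1 = w • y.1 ∧
      DagPoly.pullWord R a l (x + y) = DagPoly.pullWord R a l x + DagPoly.pullWord R a l y := by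
  induction l using List.reverseRecOn with
  | nil => exact ⟨1, by simp [DagPoly.pullWord], by simp [DagPoly.pullWord], rfl⟩
  | append_singleton l p ih =>
    obtain ⟨w, hx, hy, hxy⟩ := ih
    have h' : SameChamber R (DagPoly.pullWord R a l x).1 (DagPoly.pullWord R a l y).1 := by
      rw [hx, hy]; exact h.smul w
    obtain ⟨v, hvx, hvy, hvxy⟩ := h'.pull (a p)
    refine ⟨v * w, ?_, ?_, ?_⟩
    · rw [pullWord_append_singleton, hvx, hx, mul_smul]
    · rw [pullWord_append_singleton, hvy, hy, mul_smul]
    · rw [pullWord_append_singleton, hxy, hvxy, pullWord_append_singleton,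
        pullWord_append_singleton]

lemma sameChamber_zero (x : M) : SameChamber R x 0 := fun i => by simp

lemma pullWord_fst (a : κ → ι × ℝ) (l : List κ) (x : M × ℝ) :
    ∃ w : R.weylGroup, (pullWord R a l x).1 = w • x.1 :=
  let ⟨w, h, _⟩ := SameChamber.pullWord (y := 0) (sameChamber_zero x.1) a l
  ⟨w, h⟩

lemma pullWord_imaginary (a : κ → ι × ℝ) (l : List κ) (ζ : ℝ) :
    pullWord R a l ((0 : M), ζ) = (0, ζ) := by
  induction l using List.reverseRecOn with
  | nil => rfl
  | append_singleton l p ih =>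
    rw [pullWord_append_singleton, ih, pull_of_nonpos (by simp)]

lemma pullWord_add_imaginary (a : κ → ι × ℝ) (l : List κ) (x : M × ℝ) (ζ : ℝ) :
    pullWord R a l (x + (0, ζ)) = pullWord R a l x + (0, ζ) := by
  obtain ⟨_, _, _, h⟩ := SameChamber.pullWord (R := R) (x := x) (y := (0, ζ))
    (sameChamber_zero x.1) a l
  rw [h, pullWord_imaginary]

/-! ### Reduced words: image of the pullback and growth of imaginary parts -/

section Reduced

variable [R.IsCrystallographic] [R.IsReduced] {Δ : R.Base} {t : AffineType} {a : κ → ι × ℝ}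

/-- `x` pairs nonpositively with the positive affine roots that `h` sends to negative ones. -/
def NonposOnInversions (Δ : R.Base) (t : AffineType) (h : (M × ℝ) ≃ₗ[ℝ] (M × ℝ)) (x : M) : Prop :=
  ∀ b, IsAffRoot R t b → 0 < affHt Δ t (affVec R b) → affHt Δ t (h (affVec R b)) < 0 →
    R.coroot' b.1 x ≤ 0

/-- The image of the pullback of a reduced word. -/
lemma exists_pullWord_eq_iff (ha : IsSimpleFamily Δ t a) {l : List κ}
    (hl : IsReducedWord Δ t a l) (x : M × ℝ) :
    (∃ y, pullWord R a l y = x) ↔ NonposOnInversions Δ t (wordProd R a l) x.1 := by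
  induction l using List.reverseRecOn generalizing x with
  | nil =>
    refine ⟨fun _ b _ h₁ h₂ => absurd h₁ h₂.not_gt, fun _ => ⟨x, rfl⟩⟩
  | append_singleton l p ih =>
    have hp : 0 < affHt Δ t (wordProd R a l (affVec R (a p))) := hl l p [] rfl
    specialize ih fun l₁ q l₂ e => hl l₁ q (l₂ ++ [p]) (by rw [e]; simp)
    have hw : ∀ v, wordProd R a (l ++ [p]) v = wordProd R a l (affRefl R (a p) v) := fun v => by
      rw [wordProd_append, wordProd_cons, wordProd_nil, mul_one, LinearEquiv.mul_apply]
    have hm := affRefl_mem_affAut (ha.isAffRoot p)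
    constructor
    · rintro ⟨y, rfl⟩ b hb hbp hbn
      rw [pullWord_append_singleton]
      have hy := (ih (pullWord R a l y)).1 ⟨y, rfl⟩
      set x' := pullWord R a l y
      by_cases hbe : b = a p
      · rw [hbe]; exact coroot'_pull_nonpos _ _
      obtain ⟨b', hb', e, hx⟩ := affAut_apply_affVec hm hb
      have hb'p := ha.affHt_affRefl_pos p b hb hbp hbe
      rw [hw, e] at hbn
      rw [e] at hb'p
      have h₁ := hy b' hb' hb'p hbn
      by_cases hc : 0 < R.coroot' (a p).1 x'.1
      · rw [pull_of_nonneg hc.le, ← hx, affRefl_affRefl]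
        exact h₁
      rw [not_lt] at hc
      rw [pull_of_nonpos hc]
      -- The point was not moved. With `b' = s_p b`, one has `(x', b^∨) = (x', b'^∨) + (x',
      -- a_p^∨)(a_p, b^∨)`, which settles the case of a nonnegative pairing. For a negative one, the
      -- image of `b` under the shorter word is that of `b'` plus a negative multiple of that of
      -- `a_p`, so `b` is already an inversion of the shorter word.
      by_cases hpair : 0 ≤ R.pairing (a p).1 b.1
      · have h₂ := hx (affRefl R (a p) x')
        rw [affRefl_affRefl, affRefl_apply] at h₂
        simp only [affVec, Prod.fst_sub, Prod.smul_fst, map_sub, map_smul, smul_eq_mul,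
          root_coroot'_eq_pairing] at h₂
        nlinarith
      · have hpair' : R.pairing b.1 (a p).1 < 0 := by
          rw [pairing_nonneg_iff] at hpair
          exact not_le.1 hpair
        refine hy b hb hbp ?_
        have h₂ := congrArg (fun v => affHt Δ t (wordProd R a l v)) e
        simp only [affRefl_apply, map_sub, map_smul, smul_eq_mul] at h₂
        have h₃ : R.coroot' (a p).1 (affVec R b).1 = R.pairing b.1 (a p).1 :=
          root_coroot'_eq_pairing ..
        rw [h₃] at h₂
        nlinarith
    · intro hx
      -- The root `a p` is itself an inversion of the longer word, so `x` must be the pullback of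
      -- its reflection.
      have hxp : R.coroot' (a p).1 x.1 ≤ 0 := by
        refine hx _ (ha.isAffRoot p) (ha.affHt_pos p) ?_
        rw [hw, affRefl_affVec_self, map_neg, map_neg]
        linarith
      obtain ⟨y, hy⟩ := (ih (affRefl R (a p) x)).2 fun b hb hbp hbn => by
        have hbe : b ≠ a p := by rintro rfl; exact hbn.not_gt hp
        obtain ⟨b', hb', e, he⟩ := affAut_apply_affVec hm hb
        have hb'p := ha.affHt_affRefl_pos p b hb hbp hbe
        rw [e] at hb'p
        have h₁ := hx b' hb' hb'p (by rw [hw, ← e, affRefl_affRefl]; exact hbn)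
        rwa [← he, affRefl_affRefl]
      refine ⟨y, ?_⟩
      rw [pullWord_append_singleton, hy, pull_of_nonneg, affRefl_affRefl]
      rw [coroot'_affRefl_self]
      linarith

/-- `z` is in the weight lattice. -/
def IsWeight (R : RootPairing ι ℝ M N) (z : M) : Prop := ∀ i, ∃ n : ℤ, R.coroot' i z = n

lemma IsWeight.smul {z : M} (hz : IsWeight R z) (w : R.weylGroup) : IsWeight R (w • z) := fun i => by
  rw [coroot'_smul]; exact hz _

/-- The imaginary part grows by a nonnegative integer along the pullback of a reduced word. -/
lemma exists_nat_snd_pullWord (ha : IsSimpleFamily Δ t a) (hk : ∀ i, ∃ n : ℕ, kap R t i = n)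
    {g : (M × ℝ) ≃ₗ[ℝ] (M × ℝ)} (hg : g ∈ affAut R t)
    (hg' : ∀ b, IsAffRoot R t b → 0 < affHt Δ t (affVec R b) → 0 ≤ (g (affVec R b)).2)
    {l : List κ} (hl : IsReducedWord Δ t a l) {y : M × ℝ} (hy : IsWeight R y.1) :
    ∃ n : ℕ, (g (wordProd R a l (pullWord R a l y))).2 = (g y).2 + n := by
  induction l using List.reverseRecOn with
  | nil => exact ⟨0, by simp [wordProd, pullWord]⟩
  | append_singleton l p ih =>
    have hp : 0 < affHt Δ t (wordProd R a l (affVec R (a p))) := hl l p [] rfl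
    obtain ⟨n, hn⟩ := ih fun l₁ q l₂ e => hl l₁ q (l₂ ++ [p]) (by rw [e]; simp)
    rw [wordProd_append, wordProd_cons, wordProd_nil, mul_one, LinearEquiv.mul_apply,
      pullWord_append_singleton]
    obtain ⟨w, hw⟩ := pullWord_fst (R := R) a l y
    obtain ⟨c, hc⟩ := (hw ▸ hy.smul w : IsWeight R (pullWord R a l y).1) (a p).1
    set x := pullWord R a l y
    by_cases hx : 0 ≤ R.coroot' (a p).1 x.1
    · exact ⟨n, by rw [pull_of_nonneg hx, affRefl_affRefl, hn]⟩
    rw [not_le] at hx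
    -- A skipped reflection adds `-(x, a_p^∨)` times the image of `a p` under `g` and the preceding
    -- letters, a root with nonnegative integral imaginary part.
    rw [pull_of_nonpos hx.le, affRefl_apply, hc]
    obtain ⟨b, hb, e, -⟩ := affAut_apply_affVec (wordProd_mem_affAut ha.isAffRoot l)
      (ha.isAffRoot p)
    rw [e] at hp
    have h₁ := hg' b hb hp
    obtain ⟨b', ⟨m, hm⟩, e', -⟩ := affAut_apply_affVec hg hb
    obtain ⟨k, hk⟩ := hk b'.1
    have h₂ : (affVec R b').2 = ((m * k : ℤ) : ℝ) := by
      change b'.2 = _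
      rw [hm, hk]; simp
    rw [e', h₂] at h₁
    have h₃ : 0 ≤ m * k := by exact_mod_cast h₁
    have h₄ : c < 0 := by rw [hc] at hx; exact_mod_cast hx
    obtain ⟨r, hr⟩ := Int.eq_ofNat_of_zero_le (a := -c * (m * k))
      (mul_nonneg (by omega) h₃)
    refine ⟨n + r, ?_⟩
    rw [map_sub, map_sub, map_smul, map_smul, e, e', Prod.snd_sub, hn, Prod.smul_snd, h₂]
    have : ((r : ℤ) : ℝ) = ((-c * (m * k) : ℤ) : ℝ) := by rw [hr]
    push_cast at this ⊢
    rw [this, smul_eq_mul]; ring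

end Reduced

end

end DagPoly

namespace DagPoly

open RootPairing

noncomputable section

variable {ι M N : Type*} [Fintype ι] [AddCommGroup M] [Module ℝ M] [AddCommGroup N] [Module ℝ N]
  {R : RootPairing ι ℝ M N}

/-! ### Products of commuting simple reflections -/

section Commuting

variable {Δ : R.Base}

lemma pairing_eq_zero_swap {i j : ι} (h : R.pairing i j = 0) : R.pairing j i = 0 := by
  have := nu_pos (R := R) i
  have h₂ := pairing_mul_nu (R := R) i j
  rw [h, zero_mul, eq_comm, mul_eq_zero] at h₂
  exact h₂.resolve_right this.ne'

lemma commute_ofIdx_iff {i j : Δ.support} (hij : i ≠ j) :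
    Commute (weylGroup.ofIdx R (i : ι)) (weylGroup.ofIdx R (j : ι)) ↔ R.pairing i j = 0 := by
  constructor
  · intro h
    have h₁ := congrArg (fun w : R.weylGroup => w • R.root i) h.eq
    simp only [mul_smul, ofIdx_smul_eq, reflection_apply_self, map_neg, reflection_apply_root,
      map_sub, map_smul] at h₁
    have hl := LinearIndependent.pair_iff.1 (Δ.linearIndependent_pair_of_ne hij)
    -- Coefficients of `α_i` and `α_j` in the difference of `s_i s_j α_i` and `s_j s_i α_i`.
    have := hl (R.pairing i j * R.pairing j i) (-2 * R.pairing i j) (by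
      rw [← sub_eq_zero] at h₁
      rw [← h₁]
      module)
    linarith [this.2]
  · intro h
    refine Subtype.ext (Equiv.weightHom_injective R (LinearEquiv.ext fun x => ?_))
    exact LinearEquiv.congr_fun
      (R.isOrthogonal_comm (i : ι) (j : ι) ⟨h, pairing_eq_zero_swap h⟩).eq x

lemma finWord_smul_root_of_orthogonal {l : List Δ.support} {j : ι}
    (h : ∀ i ∈ l, R.pairing j i = 0) : finWord Δ l • R.root j = R.root j := by
  induction l with
  | nil => simp [finWord]
  | cons i l ih =>
    rw [List.forall_mem_cons] at h
    rw [finWord_cons, mul_smul, ih h.2, ofIdx_smul_eq, reflection_apply_root, h.1]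
    simp

lemma finWord_smul_root_of_mem {l : List Δ.support} (hl : l.Nodup)
    (hl' : l.Pairwise fun i j : Δ.support => R.pairing (i : ι) (j : ι) = 0) {k : Δ.support} (hk : k ∈ l) :
    finWord Δ l • R.root k = -R.root k := by
  induction l with
  | nil => simp at hk
  | cons i l ih =>
    rw [List.pairwise_cons] at hl'
    rw [finWord_cons, mul_smul]
    rcases List.mem_cons.1 hk with rfl | hk
    · rw [finWord_smul_root_of_orthogonal hl'.1, ofIdx_smul_eq, reflection_apply_self]
    · rw [ih hl.of_cons hl'.2 hk, smul_neg, ofIdx_smul_eq, reflection_apply_root,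
        pairing_eq_zero_swap (hl'.1 k hk)]
      simp

lemma isPos_finWord [R.IsCrystallographic] [R.IsReduced] {l : List Δ.support} (hl : l.Nodup)
    (hl' : l.Pairwise fun i j : Δ.support => R.pairing (i : ι) (j : ι) = 0) {β : ι} (hβ : Δ.IsPos β)
    (hβl : ∀ i ∈ l, β ≠ (i : ι)) : Δ.IsPos (R.weylGroupToPerm (finWord Δ l) β) := by
  induction l with
  | nil => simpa [finWord] using hβ
  | cons i l ih =>
    rw [List.pairwise_cons] at hl'
    rw [List.forall_mem_cons] at hβl
    have h := ih hl.of_cons hl'.2 hβl.2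
    rw [finWord_cons, map_mul, Equiv.Perm.mul_apply, weylGroupToPerm_ofIdx]
    refine h.reflectionPerm i.2 fun he => hβl.1 ?_
    have hi : R.weylGroupToPerm (finWord Δ l) i = i := by
      apply R.root.injective
      rw [← weylGroup_apply_root, finWord_smul_root_of_orthogonal hl'.1]
    rw [← hi] at he
    exact (R.weylGroupToPerm (finWord Δ l)).injective he

lemma weylGroupToPerm_eq_neg {w : R.weylGroup} {k : ι} (h : w • R.root k = -R.root k) :
    R.weylGroupToPerm w k = R.reflectionPerm k k := by
  apply R.root.injective
  rw [← weylGroup_apply_root, h, root_reflectionPerm_self]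

lemma isCommutingProduct_iff {u : R.weylGroup} : IsCommutingProduct Δ u ↔
    ∃ l : List Δ.support, l.Nodup ∧ l.Pairwise (fun i j : Δ.support => R.pairing (i : ι) (j : ι) = 0) ∧
      u = finWord Δ l := by
  refine exists_congr fun l => and_congr_right fun hl => and_congr_left fun _ => ?_
  -- The commutation relation is over `ι`, so the list enters through a monadic coercion, rewritten
  -- here as a `map`.
  have hmap : (do let a ← l; pure (a : ι)) = l.map fun i : Δ.support => (i : ι) :=
    List.flatMap_pure_eq_map _ l
  rw [hmap, List.pairwise_map]
  constructor
  · exact fun h => (h.and hl).imp fun h => (commute_ofIdx_iff h.2).1 h.1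
  · exact fun h => (h.and hl).imp fun h => (commute_ofIdx_iff h.2).2 h.1

/-- Otherwise `s_i α_j` is a nonsimple positive root, and its coroot is negative on `z`. -/
lemma neg_coroot'_pairwise_orthogonal [R.IsCrystallographic] [R.IsReduced] {z : M}
    (hz : ∀ β, Δ.IsPos β → β ∉ Δ.support → 0 ≤ R.coroot' β z) {i j : Δ.support} (hij : i ≠ j)
    (hi : R.coroot' i z < 0) (hj : R.coroot' j z < 0) : R.pairing (i : ι) (j : ι) = 0 := by
  by_contra hc
  have hne : (i : ι) ≠ j := fun h => hij (Subtype.ext h)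
  have hle : R.pairing (i : ι) (j : ι) ≤ 0 := by
    have := Δ.pairingIn_le_zero_of_ne hne i.2 j.2
    rw [← R.algebraMap_pairingIn ℤ]
    simpa using this
  have hneg := lt_of_le_of_ne hle hc
  have hneg' : R.pairing (j : ι) (i : ι) < 0 := by
    by_contra! h
    exact hneg.not_ge ((pairing_nonneg_iff _ _).1 h)
  have hpos := (Base.isPos_of_mem_support j.2).reflectionPerm i.2 hne.symm
  have := hz _ hpos fun hs => by
    have h₁ := rhoForm_simple Δ .untwisted hs
    rw [root_reflectionPerm, rhoForm_reflection Δ _ i.2, rhoForm_simple Δ _ j.2,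
      root_coroot'_eq_pairing] at h₁
    simp only [kap] at h₁
    linarith
  rw [← coroot'_reflection, reflection_apply, map_sub, map_smul, smul_eq_mul,
    root_coroot'_eq_pairing] at this
  nlinarith

/-- Nonnegativity on the non-simple positive roots characterizes the images of dominant elements
under products of commuting simple reflections. -/
lemma nonneg_on_nonsimple_iff [R.IsCrystallographic] [R.IsReduced] {b : M}
    (hb : ∀ i ∈ Δ.support, 0 ≤ R.coroot' i b) (u : R.weylGroup) :
    (∀ β, Δ.IsPos β → β ∉ Δ.support → 0 ≤ R.coroot' β (u • b)) ↔
      ∃ v, IsCommutingProduct Δ v ∧ v • b = u • b := by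
  classical
  constructor
  · intro hz
    set l := (Finset.univ.filter fun i : Δ.support => R.coroot' i (u • b) < 0).toList
    have hmem : ∀ i, i ∈ l ↔ R.coroot' i (u • b) < 0 := fun i => by
      rw [Finset.mem_toList, Finset.mem_filter]
      simp
    have hl : l.Nodup := Finset.nodup_toList _
    have hl' : l.Pairwise fun i j : Δ.support => R.pairing (i : ι) (j : ι) = 0 :=
      hl.pairwise_of_forall_ne fun i hi j hj hij =>
        neg_coroot'_pairwise_orthogonal hz hij ((hmem i).1 hi) ((hmem j).1 hj)
    refine ⟨finWord Δ l, isCommutingProduct_iff.2 ⟨l, hl, hl', rfl⟩, ?_⟩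
    -- With `v` the product of the reflections in the negative simple roots, `v⁻¹ u b` is dominant,
    -- hence equal to `b`.
    have key := smul_eq_of_dominant hb (fun _ _ h => h) ((finWord Δ l)⁻¹ * u) fun j hj => by
      rw [mul_smul, coroot'_smul, inv_inv]
      by_cases hjl : ⟨j, hj⟩ ∈ l
      · have := (hmem _).1 hjl
        rw [weylGroupToPerm_eq_neg (finWord_smul_root_of_mem hl hl' hjl),
          coroot'_reflectionPerm_self]
        exact (neg_pos.2 this).le
      have hjp := Base.isPos_of_mem_support hj
      have hp := isPos_finWord hl hl' hjp fun i hi h => hjl (by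
        rwa [show (⟨j, hj⟩ : Δ.support) = i from Subtype.ext h])
      by_cases hs : R.weylGroupToPerm (finWord Δ l) j ∈ Δ.support
      -- If `v α_j` were simple and negative on the point, it would be one of the reflected roots,
      -- so `v` would negate it, giving `α_j = -v α_j < 0`.
      · by_contra! hc
        have hk := (hmem ⟨_, hs⟩).2 hc
        have h₁ := weylGroupToPerm_eq_neg (finWord_smul_root_of_mem hl hl' hk)
        have h₂ : R.weylGroupToPerm (finWord Δ l)
            (R.reflectionPerm (R.weylGroupToPerm (finWord Δ l) j)
              (R.weylGroupToPerm (finWord Δ l) j)) = R.weylGroupToPerm (finWord Δ l) j := by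
          rw [perm_reflectionPerm_self, h₁]
          apply R.root.injective
          rw [root_reflectionPerm_self, root_reflectionPerm_self, neg_neg]
        have h₃ := (R.weylGroupToPerm (finWord Δ l)).injective h₂
        rw [← h₃, isPos_neg_iff] at hjp
        exact hjp hp
      · exact hz _ hp hs
    rw [mul_smul, inv_smul_eq_iff] at key
    exact key.symm
  · rintro ⟨v, hv, e⟩ β hβ hβs
    obtain ⟨l, hl, hl', rfl⟩ := isCommutingProduct_iff.1 hv
    rw [← e, coroot'_smul]
    refine coroot'_nonneg_of_isPos hb ?_
    by_contra hc
    set γ := R.weylGroupToPerm (finWord Δ l)⁻¹ β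
    have hγ : R.weylGroupToPerm (finWord Δ l) γ = β := by
      rw [← Equiv.Perm.mul_apply, ← map_mul, mul_inv_cancel, map_one, Equiv.Perm.one_apply]
    -- The only positive roots that `v` makes negative are those in `l`, and they are simple, unlike
    -- `β`.
    by_cases hm : ∀ i ∈ l, R.reflectionPerm γ γ ≠ (i : ι)
    · have := isPos_finWord hl hl' ((isPos_neg_iff Δ γ).2 hc) hm
      rw [perm_reflectionPerm_self, hγ, isPos_neg_iff] at this
      exact this hβ
    · push Not at hm
      obtain ⟨i, hi, hγi⟩ := hm
      have h₁ := finWord_smul_root_of_mem hl hl' hi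
      rw [← hγi, root_reflectionPerm_self, smul_neg, weylGroup_apply_root, hγ, neg_inj] at h₁
      refine hβs ?_
      rw [R.root.injective (h₁.trans (root_reflectionPerm_self γ).symm), hγi]
      exact i.2

end Commuting

/-! ### Weights and orbits -/

section Weights

lemma weylGroupToPerm_injective [R.IsRootSystem] : Function.Injective R.weylGroupToPerm := by
  intro v w h
  refine Subtype.ext (Equiv.weightHom_injective R (LinearEquiv.toLinearMap_injective
    (LinearMap.ext_on (IsRootSystem.span_root_eq_top (P := R)) ?_)))
  rintro _ ⟨i, rfl⟩
  change v • R.root i = w • R.root i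
  rw [weylGroup_apply_root, weylGroup_apply_root, h]

instance [R.IsRootSystem] : Finite R.weylGroup := Finite.of_injective _ weylGroupToPerm_injective

lemma coeff_orbitSum [R.IsRootSystem] {a x : M} (hx : x ∈ MulAction.orbit R.weylGroup a) (ζ : ℝ) :
    (orbitSum R a).coeff (x, ζ) = if ζ = 0 then 1 else 0 := by
  classical
  have hfin : (MulAction.orbit R.weylGroup a).Finite := Set.finite_range _
  rw [orbitSum, finsum_mem_eq_finite_toFinset_sum _ hfin, AddMonoidAlgebra.coeff_sum,
    Finsupp.finsetSum_apply, Finset.sum_eq_single_of_mem x (by simpa using hx)]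
  · simp [coeff_mono, eq_comm]
  · intro c _ hc
    simp [coeff_mono, hc]

variable {Δ : R.Base} {t : AffineType}

lemma IsDominant.nonneg {b : M} (hb : IsDominant Δ b) : ∀ i ∈ Δ.support, 0 ≤ R.coroot' i b :=
  fun i hi => by obtain ⟨n, hn⟩ := hb i hi; rw [hn]; positivity

lemma IsDominant.isWeight {b : M} (hb : IsDominant Δ b) : IsWeight R b := by
  have h : ∀ n ∈ AddSubmonoid.closure (R.coroot '' Δ.support),
      ∃ k : ℤ, R.toLinearMap b n = k := fun n hn => by
    induction hn using AddSubmonoid.closure_induction with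
    | mem n hn =>
      obtain ⟨i, hi, rfl⟩ := hn
      obtain ⟨k, hk⟩ := hb i hi
      exact ⟨k, by simpa using hk⟩
    | zero => exact ⟨0, by simp⟩
    | add m n _ _ hm hn =>
      obtain ⟨k, hk⟩ := hm
      obtain ⟨k', hk'⟩ := hn
      exact ⟨k + k', by rw [map_add, hk, hk']; push_cast; ring⟩
  intro i
  rcases Δ.coroot_mem_or_neg_mem i with hi | hi
  · obtain ⟨k, hk⟩ := h _ hi
    exact ⟨k, hk⟩
  · obtain ⟨k, hk⟩ := h _ hi
    rw [map_neg, neg_eq_iff_eq_neg] at hk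
    exact ⟨-k, by push_cast; exact hk⟩

lemma IsDominant.add {b c : M} (hb : IsDominant Δ b) (hc : IsDominant Δ c) :
    IsDominant Δ (b + c) := fun i hi => by
  obtain ⟨n, hn⟩ := hb i hi
  obtain ⟨m, hm⟩ := hc i hi
  exact ⟨n + m, by rw [map_add, hn, hm]; push_cast; rfl⟩

lemma IsDominant.iotaInv {w₀ : R.weylGroup} (hw₀ : IsLongest Δ w₀) {b : M}
    (hb : IsDominant Δ b) : IsDominant Δ (iotaInv w₀ b) := fun i hi => by
  obtain ⟨n, hn⟩ := hb.isWeight (R.weylGroupToPerm w₀⁻¹ i)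
  have h : R.coroot' i (DagPoly.iotaInv w₀ b) = -n := by
    rw [DagPoly.iotaInv, map_neg, coroot'_smul, hn]
  have hpos : ¬ Δ.IsPos (R.weylGroupToPerm w₀⁻¹ i) := by
    rw [← isPos_longest_iff hw₀, ← Equiv.Perm.mul_apply, ← map_mul, mul_inv_cancel, map_one,
      Equiv.Perm.one_apply]
    exact Base.isPos_of_mem_support hi
  have h₁ := coroot'_nonneg_of_isPos hb.nonneg ((isPos_neg_iff Δ _).2 hpos)
  rw [coroot'_reflectionPerm_self, hn] at h₁
  obtain ⟨m, hm⟩ := Int.eq_ofNat_of_zero_le (a := -n) (by exact_mod_cast h₁)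
  exact ⟨m, by rw [h]; exact_mod_cast hm⟩

lemma IsDominant.sameChamber {b c : M} (hb : IsDominant Δ b) (hc : IsDominant Δ c) :
    SameChamber R b c := fun i => by
  by_cases hi : Δ.IsPos i
  · exact mul_nonneg (coroot'_nonneg_of_isPos hb.nonneg hi) (coroot'_nonneg_of_isPos hc.nonneg hi)
  · rw [← isPos_neg_iff] at hi
    have h₁ := coroot'_nonneg_of_isPos hb.nonneg hi
    have h₂ := coroot'_nonneg_of_isPos hc.nonneg hi
    rw [coroot'_reflectionPerm_self] at h₁ h₂
    nlinarith

lemma IsDominant.smul_eq_left [R.IsCrystallographic] [R.IsReduced] {b c : M}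
    (hb : IsDominant Δ b) (hc : IsDominant Δ c) {w : R.weylGroup} (hw : w • (b + c) = b + c) :
    w • b = b :=
  smul_eq_of_dominant (hb.add hc).nonneg (fun i hi h => by
    rw [map_add] at h
    linarith [hb.nonneg i hi, hc.nonneg i hi]) w (by rw [hw]; exact (hb.add hc).nonneg)

lemma exists_nat_rhoForm_sub_smul [R.IsRootSystem] [R.IsCrystallographic] [R.IsReduced]
    (hk : ∀ i, ∃ n : ℕ, kap R t i = n) {b : M} (hb : IsDominant Δ b) (w : R.weylGroup) :
    ∃ n : ℕ, rhoForm Δ t b - rhoForm Δ t (w • b) = n := by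
  have hint : ∃ n : ℤ, rhoForm Δ t b - rhoForm Δ t (w • b) = n := by
    obtain ⟨l, hl⟩ := exists_finWord_smul Δ w
    rw [hl]
    clear hl
    induction l with
    | nil => exact ⟨0, by simp [finWord]⟩
    | cons i l ih =>
      obtain ⟨n, hn⟩ := ih
      obtain ⟨k, hk⟩ := hk i
      obtain ⟨m, hm⟩ := hb.isWeight.smul (finWord Δ l) i
      refine ⟨n + k * m, ?_⟩
      rw [finWord_cons, mul_smul, ofIdx_smul_eq, rhoForm_reflection Δ t i.2, hk, hm]
      push_cast
      linarith
  have hmax : rhoForm Δ t (w • b) ≤ rhoForm Δ t b := by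
    -- A maximizer of `ρ̌` on the finite orbit is dominant, since a negative simple pairing would
    -- allow an increase; so it is `b`.
    obtain ⟨v, hv⟩ := Finite.exists_max fun v : R.weylGroup => rhoForm Δ t (v • b)
    have hvb : v • b = b := smul_eq_of_dominant hb.nonneg (fun _ _ h => h) v fun i hi => by
      have h := hv (weylGroup.ofIdx R i * v)
      rw [mul_smul, ofIdx_smul_eq, rhoForm_reflection Δ t hi] at h
      exact nonneg_of_mul_nonneg_right (by linarith) (kap_pos t i)
    rw [← hvb, smul_smul]
    exact (hv (w * v)).trans_eq (by rw [hvb])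
  obtain ⟨n, hn⟩ := hint
  obtain ⟨m, hm⟩ := Int.eq_ofNat_of_zero_le (a := n) (by
    have : (0 : ℝ) ≤ n := by rw [← hn]; linarith
    exact_mod_cast this)
  exact ⟨m, by rw [hn, hm]; simp⟩

end Weights

end

end DagPoly

namespace DagPoly

open RootPairing

noncomputable section

variable {ι M N : Type*} [Fintype ι] [AddCommGroup M] [Module ℝ M] [AddCommGroup N] [Module ℝ N]
  {R : RootPairing ι ℝ M N}

/-! ### Decompositions of the translation by `ρ` -/

section Decomposition

variable [R.IsCrystallographic] [R.IsReduced] {Δ : R.Base} {t : AffineType} {w₀ : R.weylGroup}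

lemma piRho_apply (hw₀ : IsLongest Δ w₀) (x : M × ℝ) :
    piRho Δ t w₀ x = (w₀ • x.1, x.2 + rhoForm Δ t x.1) := by
  have : piRho Δ t w₀ x = (w₀ • x.1, x.2 - rhoForm Δ t (w₀ • x.1)) := rfl
  rw [this, rhoForm_longest t hw₀, sub_neg_eq_add]

lemma piRho_mem_affAut : piRho Δ t w₀ ∈ affAut R t :=
  mul_mem (transl_rhoCheck_mem_affAut Δ t) (finAct_mem_affAut w₀)

lemma affHt_neg_iff {a : ι × ℝ} (ha : IsAffRoot R t a) :
    affHt Δ t (affVec R a) < 0 ↔ ¬ AffPos Δ a := by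
  rw [← affHt_pos_iff ha, not_lt]
  exact ⟨le_of_lt, fun h => lt_of_le_of_ne h (affHt_ne_zero ha)⟩

lemma IsAffRoot.kap_le {a : ι × ℝ} (ha : IsAffRoot R t a) (h : 0 < a.2) : kap R t a.1 ≤ a.2 := by
  obtain ⟨n, hn⟩ := ha
  have hk := kap_pos (R := R) t a.1
  rw [hn] at h ⊢
  have : (0 : ℝ) < n := pos_of_mul_pos_left h hk.le
  have : (1 : ℝ) ≤ n := by exact_mod_cast this
  nlinarith

lemma nonposOnInversions_piRho_iff (hw₀ : IsLongest Δ w₀) (x : M) :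
    NonposOnInversions Δ t (piRho Δ t w₀) x ↔
      ∀ β, Δ.IsPos β → β ∉ Δ.support → 0 ≤ R.coroot' β x := by
  have himg : ∀ b, IsAffRoot R t b → (affHt Δ t (piRho Δ t w₀ (affVec R b)) < 0 ↔
      ¬ AffPos Δ (R.weylGroupToPerm w₀ b.1, b.2 + rhoForm Δ t (R.root b.1))) := by
    intro b hb
    have e : piRho Δ t w₀ (affVec R b) =
        affVec R (R.weylGroupToPerm w₀ b.1, b.2 + rhoForm Δ t (R.root b.1)) := by
      rw [piRho_apply hw₀]
      simp [affVec, weylGroup_apply_root]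
    rw [e, affHt_neg_iff]
    obtain ⟨n, hn⟩ := hb
    obtain ⟨m, hm⟩ := exists_int_rhoForm_root Δ t b.1
    exact ⟨n + m, by simp only [kap_perm, hn, hm]; push_cast; ring⟩
  constructor
  · intro h β hβ hβs
    have hk := kap_pos (R := R) t β
    -- The lowest positive affine root over `-β`; it is an inversion because `κ_β < ρ̌(β)` for
    -- nonsimple `β`.
    have ha : IsAffRoot R t (R.reflectionPerm β β, kap R t β) :=
      ⟨1, by simp [kap_reflectionPerm]⟩
    have hneg : kap R t β + -rhoForm Δ t (R.root β) < 0 := by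
      linarith [kap_lt_rhoForm_root t hβ hβs]
    have := h _ ha (affHt_pos_of_pos ha hk) ((himg _ ha).2 (by
      simp only [AffPos, root_reflectionPerm_self, map_neg, hneg.not_gt, hneg.ne, false_and,
        or_self, not_false_eq_true]))
    rw [coroot'_reflectionPerm_self] at this
    linarith
  · intro h b hb hpos hneg
    rw [affHt_pos_iff hb] at hpos
    rw [himg b hb] at hneg
    simp only [AffPos, isPos_longest_iff hw₀] at hneg
    have hp : ¬ Δ.IsPos b.1 := fun hp => hneg (.inl (by
      have := rhoForm_root_pos t hp
      have : 0 ≤ b.2 := hpos.elim le_of_lt fun h => h.1.ge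
      linarith))
    have hb2 : 0 < b.2 := hpos.resolve_right fun h => hp h.2
    have hlt : b.2 + rhoForm Δ t (R.root b.1) < 0 := by
      by_contra! hc
      exact hneg (hc.lt_or_eq.imp id fun h => ⟨h.symm, hp⟩)
    have hle := hb.kap_le hb2
    have := h _ ((isPos_neg_iff Δ _).2 hp) fun hs => by
      have h₁ := rhoForm_simple Δ t hs
      rw [root_reflectionPerm_self, map_neg, kap_reflectionPerm] at h₁
      linarith
    rw [coroot'_reflectionPerm_self] at this
    linarith

/-! ### Length-zero elements and the pullback of the full operator -/

variable [R.IsRootSystem] [R.IsIrreducible] {θ : ι} {g : (M × ℝ) ≃ₗ[ℝ] (M × ℝ)}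
  {l : List (Option Δ.support)}

lemma affHt_apply_pos (hθ : IsTheta Δ t θ) (hg : g ∈ affAut R t) (hg₀ : IsLengthZero Δ t θ g)
    {b : ι × ℝ} (hb : IsAffRoot R t b) (h : 0 < affHt Δ t (affVec R b)) :
    0 < affHt Δ t (g (affVec R b)) := by
  obtain ⟨b', hb', e, -⟩ := affAut_apply_affVec hg hb
  refine lt_of_le_of_ne (apply_affVec_nonneg hθ (affHt Δ t ∘ₗ g.toLinearMap) (fun p => ?_) hb
    ((affHt_pos_iff hb).1 h)) (by rw [e]; exact (affHt_ne_zero hb').symm)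
  obtain ⟨p', hp'⟩ : g (affVec R (simpleAff Δ θ p)) ∈
      Set.range (fun p => affVec R (simpleAff Δ θ p)) := by
    rw [← hg₀.2]; exact ⟨_, ⟨p, rfl⟩, rfl⟩
  change 0 ≤ affHt Δ t (g (affVec R (simpleAff Δ θ p)))
  rw [← hp']
  exact ((isSimpleFamily_affine hθ).affHt_pos p').le

lemma affHt_apply_neg_iff (hθ : IsTheta Δ t θ) (hg : g ∈ affAut R t)
    (hg₀ : IsLengthZero Δ t θ g) {b : ι × ℝ} (hb : IsAffRoot R t b) :
    affHt Δ t (g (affVec R b)) < 0 ↔ affHt Δ t (affVec R b) < 0 := by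
  constructor
  · intro h
    by_contra! hc
    exact h.not_gt (affHt_apply_pos hθ hg hg₀ hb (lt_of_le_of_ne hc (affHt_ne_zero hb).symm))
  · intro h
    have := affHt_apply_pos hθ hg hg₀ hb.neg (by rw [affVec_neg, map_neg]; linarith)
    rw [affVec_neg, map_neg, map_neg] at this
    linarith

lemma snd_apply_nonneg (hθ : IsTheta Δ t θ) (hg : g ∈ affAut R t) (hg₀ : IsLengthZero Δ t θ g)
    {b : ι × ℝ} (hb : IsAffRoot R t b) (h : 0 < affHt Δ t (affVec R b)) :
    0 ≤ (g (affVec R b)).2 := by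
  have hpos := affHt_apply_pos hθ hg hg₀ hb h
  obtain ⟨b', hb', e, -⟩ := affAut_apply_affVec hg hb
  rw [e, affHt_pos_iff hb'] at hpos
  rw [e]
  exact hpos.elim le_of_lt fun h => h.1.ge

lemma IsDecomposition.mem_affAut (hθ : IsTheta Δ t θ)
    (h : IsDecomposition Δ t θ (piRho Δ t w₀) g l) : g ∈ affAut R t := by
  rw [show g = piRho Δ t w₀ * (wordProd R (simpleAff Δ θ) l)⁻¹ from eq_mul_inv_of_mul_eq h.2.symm]
  exact mul_mem piRho_mem_affAut
    (inv_mem (wordProd_mem_affAut (isSimpleFamily_affine hθ).isAffRoot l))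

lemma IsReducedDecomposition.isReducedWord (hθ : IsTheta Δ t θ)
    {h : (M × ℝ) ≃ₗ[ℝ] (M × ℝ)} (hgl : IsReducedDecomposition Δ t θ h g l) :
    IsReducedWord Δ t (simpleAff Δ θ) l :=
  (isSimpleFamily_affine hθ).isReducedWord fun l' hl' =>
    hgl.2 g l' ⟨hgl.1.1, by
      rw [hgl.1.2]
      exact congrArg (g * ·) hl'.symm⟩

/-- The operator `frakT Δ θ g l` is the pullback of coefficients along this map. -/
def frakPull (Δ : R.Base) (θ : ι) (g : (M × ℝ) ≃ₗ[ℝ] (M × ℝ)) (l : List (Option Δ.support))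
    (y : M × ℝ) : M × ℝ := pullWord R (simpleAff Δ θ) l (g⁻¹ y)

lemma SameChamber.frakPull (hg : g ∈ affAut R t) {x y : M × ℝ} (h : SameChamber R x.1 y.1) :
    ∃ w : R.weylGroup, (frakPull Δ θ g l x).1 = w • x.1 ∧ (frakPull Δ θ g l y).1 = w • y.1 ∧
      DagPoly.frakPull Δ θ g l (x + y) =
        DagPoly.frakPull Δ θ g l x + DagPoly.frakPull Δ θ g l y := by
  obtain ⟨v, hv, -⟩ := inv_mem hg
  have h' : SameChamber R (g⁻¹ x).1 (g⁻¹ y).1 := by rw [hv, hv]; exact h.smul v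
  obtain ⟨w, hx, hy, hxy⟩ := h'.pullWord (simpleAff Δ θ) l
  refine ⟨w * v, ?_, ?_, ?_⟩
  · rw [DagPoly.frakPull, hx, hv, mul_smul]
  · rw [DagPoly.frakPull, hy, hv, mul_smul]
  · rw [DagPoly.frakPull, map_add, hxy]; rfl

lemma frakPull_fst (hg : g ∈ affAut R t) (x : M × ℝ) :
    ∃ w : R.weylGroup, (frakPull Δ θ g l x).1 = w • x.1 :=
  let ⟨w, h, _⟩ := SameChamber.frakPull (y := 0) hg (sameChamber_zero x.1)
  ⟨w, h⟩

lemma frakPull_add_imaginary (hg : g ∈ affAut R t) (x : M × ℝ) (ζ : ℝ) :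
    frakPull Δ θ g l (x + (0, ζ)) = frakPull Δ θ g l x + (0, ζ) := by
  obtain ⟨v, -, hd, -⟩ := inv_mem hg
  have : g⁻¹ ((0 : M), ζ) = (0, ζ) := by
    have e : ((0 : M), ζ) = ζ • (0, 1) := by simp
    rw [e, map_smul, hd]
  rw [frakPull, map_add, this, pullWord_add_imaginary]
  rfl

lemma exists_frakPull_eq_iff (hθ : IsTheta Δ t θ) (hw₀ : IsLongest Δ w₀)
    (hgl : IsReducedDecomposition Δ t θ (piRho Δ t w₀) g l) (x : M × ℝ) :
    (∃ y, frakPull Δ θ g l y = x) ↔ ∀ β, Δ.IsPos β → β ∉ Δ.support → 0 ≤ R.coroot' β x.1 := by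
  have hg := hgl.1.mem_affAut hθ
  have ha := isSimpleFamily_affine hθ
  rw [← nonposOnInversions_piRho_iff (t := t) hw₀]
  have h₁ : (∃ y, frakPull Δ θ g l y = x) ↔ ∃ y, pullWord R (simpleAff Δ θ) l y = x :=
    ((g⁻¹ : (M × ℝ) ≃ₗ[ℝ] (M × ℝ)).surjective.exists
      (p := fun y => pullWord R (simpleAff Δ θ) l y = x)).symm
  rw [h₁, exists_pullWord_eq_iff ha (hgl.isReducedWord hθ)]
  refine forall_congr' fun b => forall_congr' fun hb => imp_congr_right fun _ =>
    imp_congr_left ?_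
  obtain ⟨b', hb', e, -⟩ := affAut_apply_affVec (wordProd_mem_affAut ha.isAffRoot l) hb
  have : piRho Δ t w₀ (affVec R b) = g (wordProd R (simpleAff Δ θ) l (affVec R b)) := by
    rw [hgl.1.2]; rfl
  rw [this, e, affHt_apply_neg_iff hθ hg hgl.1.1 hb']

lemma iotaInv_eq (w₀ : R.weylGroup) (b : M) : iotaInv w₀ b = w₀ • (-b) := by
  rw [iotaInv, smul_neg]

lemma exists_nat_snd_frakPull (hθ : IsTheta Δ t θ) (hw₀ : IsLongest Δ w₀)
    (hgl : IsReducedDecomposition Δ t θ (piRho Δ t w₀) g l) {b : M} (hb : IsDominant Δ b)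
    (w : R.weylGroup) :
    ∃ n : ℕ, (frakPull Δ θ g l (w • (-b), 0)).2 + rhoForm Δ t b = n := by
  have hg := hgl.1.mem_affAut hθ
  have hk := exists_nat_kap hθ
  obtain ⟨v', hv', -⟩ := inv_mem hg
  have hwt : IsWeight R (g⁻¹ (w • (-b), 0)).1 := by
    rw [hv']
    refine IsWeight.smul (IsWeight.smul (fun i => ?_) w) v'
    obtain ⟨n, hn⟩ := hb.isWeight i
    exact ⟨-n, by rw [map_neg, hn]; push_cast; rfl⟩
  obtain ⟨n, hn⟩ := exists_nat_snd_pullWord (isSimpleFamily_affine hθ) hk hg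
    (fun b hb h => snd_apply_nonneg hθ hg hgl.1.1 hb h) (hgl.isReducedWord hθ) hwt
  have e₁ : g (wordProd R (simpleAff Δ θ) l (frakPull Δ θ g l (w • (-b), 0))) =
      piRho Δ t w₀ (frakPull Δ θ g l (w • (-b), 0)) := by rw [hgl.1.2]; rfl
  have e₂ : g (g⁻¹ (w • (-b), 0)) = (w • (-b), 0) := by
    rw [← LinearEquiv.mul_apply, mul_inv_cancel]; rfl
  rw [e₂, zero_add] at hn
  change (g (wordProd R (simpleAff Δ θ) l (frakPull Δ θ g l (w • (-b), 0)))).2 = n at hn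
  rw [e₁, piRho_apply hw₀] at hn
  obtain ⟨v, hv⟩ := frakPull_fst (l := l) (θ := θ) (Δ := Δ) hg (w • (-b), 0)
  -- So far `n` is the imaginary part plus `ρ̌` of the pulled-back weight; `m` replaces that value
  -- by the maximum `ρ̌(b^ι) = ρ̌(b)` over the orbit.
  obtain ⟨m, hm⟩ := exists_nat_rhoForm_sub_smul hk (hb.iotaInv hw₀) (v * w * w₀⁻¹)
  have e₃ : (v * w * w₀⁻¹) • iotaInv w₀ b = (frakPull Δ θ g l (w • (-b), 0)).1 := by
    rw [hv, iotaInv_eq, mul_smul, inv_smul_smul, mul_smul]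
  have e₄ : rhoForm Δ t (iotaInv w₀ b) = rhoForm Δ t b := by
    rw [iotaInv, map_neg, rhoForm_longest t hw₀, neg_neg]
  rw [e₃, e₄] at hm
  refine ⟨n + m, ?_⟩
  push_cast
  rw [← hn, ← hm]
  ring

end Decomposition

/-! ### Extremal dag-polynomials -/

section Dag

variable [R.IsRootSystem] [R.IsCrystallographic] [R.IsReduced] [R.IsIrreducible] {Δ : R.Base}
  {t : AffineType} {w₀ : R.weylGroup} {θ : ι} {g : (M × ℝ) ≃ₗ[ℝ] (M × ℝ)}
  {l : List (Option Δ.support)}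

lemma coeff_qRho_neg_mul (b : M) (f : QPoly M) (y : M) (ζ : ℝ) :
    (qRho Δ t (-b) * f).coeff (y, ζ) = f.coeff (y, ζ + rhoForm Δ t b) := by
  have h : qRho Δ t (-b) = AddMonoidAlgebra.single (0, -rhoForm Δ t b) 1 := by
    rw [← map_neg]; rfl
  rw [h, AddMonoidAlgebra.coeff_single_mul_apply, one_mul, Prod.neg_mk, Prod.mk_add_mk, neg_zero,
    zero_add, neg_neg, add_comm]

lemma frakPull_mk (hg : g ∈ affAut R t) (y : M) (ζ : ℝ) :
    frakPull Δ θ g l (y, ζ) =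
      ((frakPull Δ θ g l (y, 0)).1, (frakPull Δ θ g l (y, 0)).2 + ζ) := by
  have e : (y, ζ) = (y, (0 : ℝ)) + (0, ζ) := by simp
  rw [e, frakPull_add_imaginary hg]
  ext <;> simp

lemma coeff_dagPoly_eq (hg : g ∈ affAut R t) (b : M) (w : R.weylGroup) (ζ : ℝ) :
    (dagPoly Δ t (frakT Δ θ g l) (-b)).coeff (w • (-b), ζ) =
      if (frakPull Δ θ g l (w • (-b), 0)).2 + (ζ + rhoForm Δ t b) = 0 then 1 else 0 := by
  rw [dagPoly, coeff_qRho_neg_mul, coeff_frakT]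
  change (orbitSum R (-b)).coeff (frakPull Δ θ g l _) = _
  rw [frakPull_mk hg, coeff_orbitSum]
  obtain ⟨v, hv⟩ := frakPull_fst (l := l) (θ := θ) (Δ := Δ) hg (w • (-b), 0)
  exact ⟨v * w, by rw [hv]; exact mul_smul ..⟩

lemma cast_dagDeg (hθ : IsTheta Δ t θ) (hw₀ : IsLongest Δ w₀)
    (hgl : IsReducedDecomposition Δ t θ (piRho Δ t w₀) g l) {b : M} (hb : IsDominant Δ b)
    (w : R.weylGroup) :
    (dagDeg Δ t (frakT Δ θ g l) b w : ℝ) =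
      (frakPull Δ θ g l (w • (-b), 0)).2 + rhoForm Δ t b := by
  obtain ⟨n, hn⟩ := exists_nat_snd_frakPull hθ hw₀ hgl hb w
  rw [hn]
  -- The set of exponents is a singleton, so the infimum in `dagDeg` is not a default value.
  have : {e : ℕ | (dagPoly Δ t (frakT Δ θ g l) (-b)).coeff (w • (-b), -(e : ℝ)) ≠ 0} = {n} := by
    ext e
    rw [Set.mem_ofPred_eq, coeff_dagPoly_eq (hgl.1.mem_affAut hθ), Set.mem_singleton_iff,
      show (frakPull Δ θ g l (w • (-b), 0)).2 + (-(e : ℝ) + rhoForm Δ t b) = n - e by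
        rw [← hn]; ring]
    simp [sub_eq_zero, eq_comm]
  rw [dagDeg, this, csInf_singleton]

lemma coeff_dagPoly (hθ : IsTheta Δ t θ) (hw₀ : IsLongest Δ w₀)
    (hgl : IsReducedDecomposition Δ t θ (piRho Δ t w₀) g l) {b : M} (hb : IsDominant Δ b)
    (w : R.weylGroup) (ζ : ℝ) :
    (dagPoly Δ t (frakT Δ θ g l) (-b)).coeff (w • (-b), ζ) =
      if ζ = -(dagDeg Δ t (frakT Δ θ g l) b w : ℝ) then 1 else 0 := by
  rw [coeff_dagPoly_eq (hgl.1.mem_affAut hθ), cast_dagDeg hθ hw₀ hgl hb]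
  refine if_congr ⟨fun h => ?_, fun h => ?_⟩ rfl rfl <;> linarith

lemma arises_iff (hθ : IsTheta Δ t θ) (hw₀ : IsLongest Δ w₀)
    (hgl : IsReducedDecomposition Δ t θ (piRho Δ t w₀) g l) {b : M} (hb : IsDominant Δ b)
    (w u : R.weylGroup) :
    Arises Δ t w₀ (frakT Δ θ g l) b w u ↔
      u • iotaInv w₀ b = (frakPull Δ θ g l (w • (-b), 0)).1 := by
  classical
  rw [Arises, coeff_qRho_neg_mul, coeff_frakT]
  change (mono _).coeff (frakPull Δ θ g l _) ≠ 0 ↔ _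
  rw [frakPull_mk (hgl.1.mem_affAut hθ), cast_dagDeg hθ hw₀ hgl hb, coeff_mono]
  simp

lemma frakT_mono_ne_zero_iff (hθ : IsTheta Δ t θ) (hw₀ : IsLongest Δ w₀)
    (hgl : IsReducedDecomposition Δ t θ (piRho Δ t w₀) g l) {b : M} (hb : IsDominant Δ b)
    (u : R.weylGroup) :
    frakT Δ θ g l (mono (u • b, 0)) ≠ 0 ↔ ∃ v, IsCommutingProduct Δ v ∧ v • b = u • b := by
  classical
  rw [← nonneg_on_nonsimple_iff hb.nonneg,
    ← exists_frakPull_eq_iff hθ hw₀ hgl (u • b, 0), Ne, AddMonoidAlgebra.ext_iff, Finsupp.ext_iff,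
    not_forall]
  refine exists_congr fun y => ?_
  rw [coeff_frakT]
  change ¬ (mono _).coeff (frakPull Δ θ g l y) = 0 ↔ _
  rw [coeff_mono]
  simp [eq_comm]

/-- A common description of the blocks from which the extremal monomials for `b`, `c` and `b + c`
arise, and the additivity of the degrees. -/
lemma exists_arises_iff_smul_eq (hθ : IsTheta Δ t θ) (hw₀ : IsLongest Δ w₀)
    (hgl : IsReducedDecomposition Δ t θ (piRho Δ t w₀) g l) {b c : M} (hb : IsDominant Δ b)
    (hc : IsDominant Δ c) (w u : R.weylGroup) :
    dagDeg Δ t (frakT Δ θ g l) (b + c) w =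
      dagDeg Δ t (frakT Δ θ g l) b w + dagDeg Δ t (frakT Δ θ g l) c w ∧
    ∃ h : R.weylGroup, (Arises Δ t w₀ (frakT Δ θ g l) b w u ↔ h • b = b) ∧
      (Arises Δ t w₀ (frakT Δ θ g l) c w u ↔ h • c = c) ∧
      (Arises Δ t w₀ (frakT Δ θ g l) (b + c) w u ↔ h • (b + c) = b + c) := by
  have hg := hgl.1.mem_affAut hθ
  have hch : SameChamber R (w • (-b)) (w • (-c)) :=
    SameChamber.smul (fun i => by
      rw [map_neg, map_neg, neg_mul_neg]; exact hb.sameChamber hc i) w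
  obtain ⟨v, hvb, hvc, hadd⟩ := SameChamber.frakPull (Δ := Δ) (θ := θ) (l := l)
    (x := (w • (-b), 0)) (y := (w • (-c), 0)) hg hch
  have e : ((w • (-b), 0) + (w • (-c), 0) : M × ℝ) = (w • (-(b + c)), 0) := by
    rw [Prod.mk_add_mk, ← smul_add, ← neg_add, add_zero]
  rw [e] at hadd
  have hvbc : (frakPull Δ θ g l (w • (-(b + c)), 0)).1 = v • w • (-(b + c)) := by
    rw [hadd, Prod.fst_add, hvb, hvc, ← smul_add, ← smul_add, ← neg_add]
  -- As `v` serves `b`, `c` and `b + c` alike, the three occurrence conditions concern the same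
  -- element `(u w₀)⁻¹ v w`.
  have key : ∀ x : M, u • iotaInv w₀ x = v • w • (-x) ↔ ((u * w₀)⁻¹ * (v * w)) • x = x := by
    intro x
    rw [iotaInv_eq, mul_smul, inv_smul_eq_iff, mul_smul, mul_smul, smul_neg, smul_neg, smul_neg,
      smul_neg, neg_inj, eq_comm]
  refine ⟨?_, (u * w₀)⁻¹ * (v * w), ?_, ?_, ?_⟩
  · have h := cast_dagDeg hθ hw₀ hgl (hb.add hc) w
    rw [hadd, Prod.snd_add, map_add] at h
    have h₁ := cast_dagDeg hθ hw₀ hgl hb w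
    have h₂ := cast_dagDeg hθ hw₀ hgl hc w
    have : (dagDeg Δ t (frakT Δ θ g l) (b + c) w : ℝ) =
        (dagDeg Δ t (frakT Δ θ g l) b w + dagDeg Δ t (frakT Δ θ g l) c w : ℕ) := by
      push_cast
      linarith
    exact_mod_cast this
  · rw [arises_iff hθ hw₀ hgl hb, hvb, key]
  · rw [arises_iff hθ hw₀ hgl hc, hvc, key]
  · rw [arises_iff hθ hw₀ hgl (hb.add hc), hvbc, key]

end Dag

end

end DagPoly

open DagPoly in
theorem theorem3p3 {ι M N : Type*} [Fintype ι]
    [AddCommGroup M] [Module ℝ M] [AddCommGroup N] [Module ℝ N]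
    (R : RootPairing ι ℝ M N) [R.IsRootSystem] [R.IsCrystallographic] [R.IsReduced]
    [R.IsIrreducible] (Δ : R.Base) (t : AffineType)
    (θ : ι) (hθ : IsTheta Δ t θ)
    (w₀ : R.weylGroup) (hw₀ : IsLongest Δ w₀)
    (g : (M × ℝ) ≃ₗ[ℝ] (M × ℝ)) (l : List (Option Δ.support))
    (hgl : IsReducedDecomposition Δ t θ (piRho Δ t w₀) g l)
    (T : AddMonoid.End (QPoly M)) (hT : T = frakT Δ θ g l) :
    -- `𝔗(X_{u(b)})` is nonzero iff `u`, modulo `W^b`, is a product of commuting reflections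
    (∀ b, IsDominant Δ b → ∀ u : R.weylGroup,
      T (mono (u • b, 0)) ≠ 0 ↔ ∃ v, IsCommutingProduct Δ v ∧ v • b = u • b) ∧
    -- the coefficient of `X_{w(-b)}` in `𝔼_{-b}` is exactly `q^{-e(b, w)}`
    (∀ b, IsDominant Δ b → ∀ w : R.weylGroup, ∀ ζ : ℝ,
      (dagPoly Δ t T (-b)).coeff (w • (-b), ζ) = if ζ = -(dagDeg Δ t T b w : ℝ) then 1 else 0) ∧
    -- each extremal monomial arises from exactly one such `u`, modulo the stabilizer of `b^ι`
    (∀ b, IsDominant Δ b → ∀ w : R.weylGroup,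
      ∃ u, IsCommutingProduct Δ u ∧ Arises Δ t w₀ T b w u ∧
        ∀ u', Arises Δ t w₀ T b w u' ↔ u' • iotaInv w₀ b = u • iotaInv w₀ b) ∧
    -- additivity for those `u` from which the monomial of `b + c` arises
    (∀ b c, IsDominant Δ b → IsDominant Δ c → ∀ w u : R.weylGroup,
      Arises Δ t w₀ T (b + c) w u →
        Arises Δ t w₀ T b w u ∧ Arises Δ t w₀ T c w u ∧
        refDeg Δ t w₀ T (b + c) w u = refDeg Δ t w₀ T b w u + refDeg Δ t w₀ T c w u) ∧
    -- additivity for all `u`, if `b` and `c` have the same stabilizer (for instance, if both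
    -- are regular)
    (∀ b c, IsDominant Δ b → IsDominant Δ c →
      MulAction.stabilizer R.weylGroup b = MulAction.stabilizer R.weylGroup c →
      ∀ w u : R.weylGroup,
        refDeg Δ t w₀ T (b + c) w u = refDeg Δ t w₀ T b w u + refDeg Δ t w₀ T c w u) := by
  subst hT
  refine ⟨fun b hb u => frakT_mono_ne_zero_iff hθ hw₀ hgl hb u,
    fun b hb w ζ => coeff_dagPoly hθ hw₀ hgl hb w ζ, fun b hb w => ?_,
    fun b c hb hc w u h => ?_, fun b c hb hc hst w u => ?_⟩
  · obtain ⟨v, hv⟩ := frakPull_fst (Δ := Δ) (θ := θ) (l := l) (hgl.1.mem_affAut hθ) (w • (-b), 0)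
    have hx : (v * w * w₀⁻¹) • iotaInv w₀ b = (frakPull Δ θ g l (w • (-b), 0)).1 := by
      rw [hv, iotaInv_eq, mul_smul, inv_smul_smul, mul_smul]
    have hpos := (exists_frakPull_eq_iff hθ hw₀ hgl _).1 ⟨(w • (-b), 0), rfl⟩
    rw [← hx] at hpos
    obtain ⟨u, hu, hux⟩ := (nonneg_on_nonsimple_iff (hb.iotaInv hw₀).nonneg _).1 hpos
    rw [hx] at hux
    refine ⟨u, hu, (arises_iff hθ hw₀ hgl hb w u).2 hux, fun u' => ?_⟩
    rw [arises_iff hθ hw₀ hgl hb, hux]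
  · obtain ⟨hdeg, k, h₁, h₂, h₃⟩ := exists_arises_iff_smul_eq hθ hw₀ hgl hb hc w u
    have hk := h₃.1 h
    have hb' := h₁.2 (hb.smul_eq_left hc hk)
    have hc' := h₂.2 (hc.smul_eq_left hb (by rwa [add_comm]))
    exact ⟨hb', hc', by rw [refDeg, refDeg, refDeg, if_pos h, if_pos hb', if_pos hc', hdeg]⟩
  · obtain ⟨hdeg, k, h₁, h₂, h₃⟩ := exists_arises_iff_smul_eq hθ hw₀ hgl hb hc w u
    have hbc : k • b = b ↔ k • c = c := by
      rw [← MulAction.mem_stabilizer_iff, hst, MulAction.mem_stabilizer_iff]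
    rw [refDeg, refDeg, refDeg]
    -- With equal stabilizers the three monomials arise from `u` together or not at all; in the
    -- second case all refined degrees are zero.
    by_cases hk : k • b = b
    · rw [if_pos (h₃.2 (by rw [smul_add, hk, hbc.1 hk])), if_pos (h₁.2 hk),
        if_pos (h₂.2 (hbc.1 hk)), hdeg]
    · rw [if_neg fun h => hk (hb.smul_eq_left hc (h₃.1 h)), if_neg fun h => hk (h₁.1 h),
        if_neg fun h => hk (hbc.2 (h₂.1 h))]
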